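/- **Proposition.** Conventions: systems are finite-dimensional. A *channel* $\Theta:A\to B$ is a completely positive trace-preserving map, with Choi state $\varrho_\Theta=(\mathrm{id}\otimes\Theta)(|\Psi_+\rangle\langle\Psi_+|)$, $\Psi_+=d_A^{-1/2}\sum_i|ii\rangle$. A *conclusive operation* is a completely positive map that does not increase the trace of positive operators. The natural measure on channels is the Euclidean (Hilbert–Schmidt) volume of the set of their Choi states inside the real affine space of Hermitian operators on $A\otimes B$ whose first marginal is $I/d_A$. A channel $\Theta:A\to B$ *allows perfect probabilistic correction* if there are a conclusive operation $D:B\to A$ and $p>0$ with $D\circ\Theta=p\cdot\mathrm{id}$; it does so *with coding* if $D\circ\Theta\circ E=p\cdot\mathrm{id}$ for some conclusive operations $E:A\to A$, $D:B\to A$ and $p>0$. It *allows quasi-probabilistic correction* if there are conclusive operations $E_n:A\to A$, $D_n:B\to A$ and numbers $p_n>0$, $p_n\to0$, with $p_n^{-1}D_n\Theta E_n\to\mathrm{id}$. A state $\varrho$ on $\mathbb C^d\otimes\mathbb C^d$ is *quasidistillable* if there are conclusive LOCC operations $\Lambda_n$ with $\operatorname{Tr}\Lambda_n(\varrho)>0$,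 $\operatorname{Tr}\Lambda_n(\varrho)\to0$ and $\langle\Psi_+|\Lambda_n(\varrho)|\Psi_+\rangle/\operatorname{Tr}\Lambda_n(\varrho)\to1$. 1. For all $d_A\ge2$, $d_B\ge1$, the set of all channels $A\to B$ has finite nonzero measure, and the channels that allow perfect probabilistic correction, even with coding, form a set of measure zero. 2. For every $n\ge1$ there are channels $\Theta=\theta_1\otimes\dots\otimes\theta_n$ on $n$ qubits (local errors) with all $\theta_i\ne\mathrm{id}$ that allow perfect probabilistic correction. There are also such product channels that allow quasi-probabilistic correction although neither $\Theta$ nor any $\theta_i$ allows perfect probabilistic correction, even with coding. 3. Let $a,b>0$, $a^2+b^2=1$, $|\Psi\rangle=a|00\rangle+b|11\rangle$. Then $$\varrho_{a,b}=\frac{b}{a+b}|\Psi\rangle\langle\Psi|+\frac{a}{a+b}|01\rangle\langle01|$$ is a quasidistillable two-qubit state, and $\varrho_{a,b}=(C\otimes I)\varrho_\theta(C\otimes I)^\dagger$ for some positive definite $C$ and some qubit channel $\theta$ that allows quasi-probabilistic correction but not perfect probabilistic correction, even with coding. For some such $a,b$ the state $\varrho_{a,b}$ is itself the Choi state of such a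 channel. -/

import Mathlib

open scoped ComplexOrder Kronecker
open Filter Topology

namespace ProbQEC

/-! ### States and superoperators on finite-dimensional systems

A system with orthonormal basis indexed by a finite type `A` has operator algebra `Matrix A A ℂ`;
the composite of the systems `A` and `B` is indexed by `A × B`. -/

/-- Superoperators: complex linear maps from operators on `A` to operators on `B`. -/
abbrev SuperOp (A B : Type*) : Type _ := Matrix A A ℂ →ₗ[ℂ] Matrix B B ℂ

/-- Density operators. -/
def IsState {A : Type*} [Fintype A] (ρ : Matrix A A ℂ) : Prop :=
  ρ.PosSemidef ∧ ρ.trace = 1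

/-- `(id_R ⊗ Φ)(X)` for an operator `X` on `R ⊗ A`. -/
def onSecond {R A B : Type*} (Φ : SuperOp A B) (X : Matrix (R × A) (R × A) ℂ) :
    Matrix (R × B) (R × B) ℂ :=
  Matrix.of fun x y => Φ (Matrix.of fun a a' => X (x.1, a) (y.1, a')) x.2 y.2

/-- Complete positivity: `id_k ⊗ Φ` preserves positive semidefiniteness for every `k`. -/
def IsCP {A B : Type*} (Φ : SuperOp A B) : Prop :=
  ∀ (k : ℕ) (X : Matrix (Fin k × A) (Fin k × A) ℂ), X.PosSemidef → (onSecond Φ X).PosSemidef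

/-- Quantum channels: completely positive trace-preserving maps. -/
def QChannel (A B : Type*) [Fintype A] [Fintype B] : Type _ :=
  {Θ : SuperOp A B // IsCP Θ ∧ ∀ X, (Θ X).trace = X.trace}

/-- Conclusive (heralded) quantum operations: completely positive maps that do not increase the
trace of positive operators.  The trace of the output is the probability of success. -/
def IsQuantumOperation {A B : Type*} [Fintype A] [Fintype B] (Φ : SuperOp A B) : Prop :=
  IsCP Φ ∧ ∀ X : Matrix A A ℂ, X.PosSemidef → (Φ X).trace.re ≤ X.trace.re

/-! ### Maximally entangled state, singlet fraction, Choi state -/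

/-- The vector `Ψ₊ = d^{-1/2} ∑ i, |i⟩ ⊗ |i⟩`. -/
noncomputable def psiPlus (A : Type*) [Fintype A] [DecidableEq A] : A × A → ℂ :=
  fun x => if x.1 = x.2 then ((Real.sqrt (Fintype.card A))⁻¹ : ℝ) else 0

/-- The rank-one operator `|v⟩⟨v|`. -/
def ketbra {I : Type*} (v : I → ℂ) : Matrix I I ℂ := Matrix.vecMulVec v (star v)

/-- The singlet fraction `F(ρ) = ⟨Ψ₊|ρ|Ψ₊⟩`. -/
noncomputable def singletFraction {A : Type*} [Fintype A] [DecidableEq A]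
    (ρ : Matrix (A × A) (A × A) ℂ) : ℝ :=
  (star (psiPlus A) ⬝ᵥ (ρ.mulVec (psiPlus A))).re

/-- The state `(id ⊗ Θ)(|Ψ₊⟩⟨Ψ₊|)` of a superoperator `Θ`. -/
noncomputable def choiState {A B : Type*} [Fintype A] [DecidableEq A] (Θ : SuperOp A B) :
    Matrix (A × B) (A × B) ℂ :=
  onSecond Θ (ketbra (psiPlus A))

/-- The partial trace over the second system. -/
def traceSecond {A B : Type*} [Fintype B] (X : Matrix (A × B) (A × B) ℂ) : Matrix A A ℂ :=
  Matrix.of fun a a' => ∑ b, X (a, b) (a', b)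

/-! ### The natural measure on channels -/

/-- The real vector space of Hermitian operators on `A ⊗ B` with vanishing partial trace over `B`:
the direction of the affine space of Hermitian operators whose first marginal is maximally mixed,
in which the Choi states of channels form a convex body. -/
def choiDirection (A B : Type*) [Fintype B] : Submodule ℝ (Matrix (A × B) (A × B) ℂ) where
  carrier := {X | X.IsHermitian ∧ traceSecond X = 0}
  add_mem' := by
    rintro X Y ⟨hX, hX'⟩ ⟨hY, hY'⟩
    refine ⟨hX.add hY, ?_⟩
    have h : traceSecond (X + Y) = traceSecond X + traceSecond Y := by
      ext a a'; simp [traceSecond, Finset.sum_add_distrib]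
    rw [h, hX', hY', add_zero]
  zero_mem' := ⟨Matrix.isHermitian_zero, by ext a a'; simp [traceSecond]⟩
  smul_mem' := by
    rintro c X ⟨hX, hX'⟩
    refine ⟨?_, ?_⟩
    · ext x y
      have h := congrFun (congrFun hX x) y
      simp only [Matrix.conjTranspose_apply] at h
      simp [Matrix.conjTranspose_apply, h]
    · have h : traceSecond (c • X) = c • traceSecond X := by
        ext a a'; simp [traceSecond, Finset.mul_sum]
      rw [h, hX', smul_zero]

/-- An operator as a point of the Euclidean space of its matrix entries, so that distances are the
Hilbert–Schmidt distances `‖X - Y‖ = √(Tr (X - Y)†(X - Y))`. -/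
noncomputable def hsVector {I : Type*} [Fintype I] (X : Matrix I I ℂ) : EuclideanSpace ℂ (I × I) :=
  WithLp.toLp 2 fun x => X x.1 x.2

/-- The natural (Hilbert–Schmidt) measure of a set of channels: the Euclidean volume (Hausdorff
measure normalized to agree with Lebesgue measure), in the dimension of the affine space of
Hermitian operators with maximally mixed first marginal, of the set of their Choi states. -/
noncomputable def channelVolume {A B : Type*} [Fintype A] [DecidableEq A] [Fintype B]
    (S : Set (QChannel A B)) : ENNReal :=
  (MeasureTheory.Measure.euclideanHausdorffMeasure (Module.finrank ℝ (choiDirection A B)) :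
      MeasureTheory.Measure (EuclideanSpace ℂ ((A × B) × (A × B))))
    ((fun Θ : QChannel A B => hsVector (choiState Θ.1)) '' S)

/-! ### Probabilistic and quasi-probabilistic error correction -/

/-- Perfect probabilistic error correction: the whole system `A` is sent through `Θ` without coding
and a conclusive operation of the receiver, who learns whether it has succeeded, restores the input
exactly, with a nonzero probability of success `p`. -/
def AllowsPerfectCorrection {A B : Type*} [Fintype A] [Fintype B] (Θ : SuperOp A B) : Prop :=
  ∃ (D : SuperOp B A) (p : ℝ), IsQuantumOperation D ∧ 0 < p ∧
    ∀ X, D (Θ X) = (p : ℂ) • X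

/-- Perfect probabilistic error correction where, moreover, the sender may apply any conclusive
operation (in particular any unitary coding, or any filter) to the system before sending it. -/
def AllowsPerfectCorrectionWithCoding {A B : Type*} [Fintype A] [Fintype B] (Θ : SuperOp A B) :
    Prop :=
  ∃ (E : SuperOp A A) (D : SuperOp B A) (p : ℝ),
    IsQuantumOperation E ∧ IsQuantumOperation D ∧ 0 < p ∧ ∀ X, D (Θ (E X)) = (p : ℂ) • X

/-- Quasi-probabilistic error correction: there are conclusive operations `E n` of the sender and
`D n` of the receiver such that, conditioned on success, the input is restored better and better,
while the probability of success goes to zero. -/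
def AllowsQuasiCorrection {A B : Type*} [Fintype A] [Fintype B] (Θ : SuperOp A B) : Prop :=
  ∃ (E : ℕ → SuperOp A A) (D : ℕ → SuperOp B A) (p : ℕ → ℝ),
    (∀ n, IsQuantumOperation (E n) ∧ IsQuantumOperation (D n) ∧ 0 < p n) ∧
    Tendsto p atTop (𝓝 0) ∧
    ∀ X : Matrix A A ℂ, Tendsto (fun n => ((p n : ℂ))⁻¹ • D n (Θ (E n X))) atTop (𝓝 X)

/-- The local error assumption on an `n`-qubit channel `Θ`: the qubits interact with their
environments independently, that is, `Θ = θ 0 ⊗ ⋯ ⊗ θ (n - 1)` for the single-qubit channels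
`θ i`. -/
def IsLocalErrorChannel {n : ℕ} (θ : Fin n → QChannel (Fin 2) (Fin 2))
    (Θ : QChannel (Fin n → Fin 2) (Fin n → Fin 2)) : Prop :=
  ∀ X : Fin n → Matrix (Fin 2) (Fin 2) ℂ,
    Θ.1 (Matrix.of fun s t => ∏ i, X i (s i) (t i)) =
      Matrix.of fun s t => ∏ i, (θ i).1 (X i) (s i) (t i)

/-! ### Quasidistillation by local operations and classical communication -/

/-- The map `X ↦ K X K†`. -/
noncomputable def conjBy {A : Type*} [Fintype A] (K : Matrix A A ℂ) : SuperOp A A :=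
  LinearMap.mulLeft ℂ K ∘ₗ LinearMap.mulRight ℂ K.conjTranspose

/-- Conclusive LOCC operations on `A ⊗ B` (finite two-way protocols): the parties may stop and keep
the particles, stop and throw them away, or one of them performs a local measurement with Kraus
operators `K j`, announces the result `j`, and they go on with a protocol depending on `j`. -/
inductive IsLOCC {A B : Type*} [Fintype A] [DecidableEq A] [Fintype B] [DecidableEq B] :
    SuperOp (A × B) (A × B) → Prop
  | keep : IsLOCC LinearMap.id
  | discard : IsLOCC 0
  | alice {r : ℕ} (K : Fin r → Matrix A A ℂ) (Λ : Fin r → SuperOp (A × B) (A × B))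
      (hK : ∑ j, (K j).conjTranspose * K j = 1) (hΛ : ∀ j, IsLOCC (Λ j)) :
      IsLOCC (∑ j, Λ j ∘ₗ conjBy (K j ⊗ₖ (1 : Matrix B B ℂ)))
  | bob {r : ℕ} (K : Fin r → Matrix B B ℂ) (Λ : Fin r → SuperOp (A × B) (A × B))
      (hK : ∑ j, (K j).conjTranspose * K j = 1) (hΛ : ∀ j, IsLOCC (Λ j)) :
      IsLOCC (∑ j, Λ j ∘ₗ conjBy ((1 : Matrix A A ℂ) ⊗ₖ K j))

/-- Single copy quasidistillability: some conclusive LOCC operations bring the singlet fraction of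
the normalized output arbitrarily close to one, with probability of success going to zero. -/
def IsQuasiDistillable {A : Type*} [Fintype A] [DecidableEq A]
    (ρ : Matrix (A × A) (A × A) ℂ) : Prop :=
  ∃ Λ : ℕ → SuperOp (A × A) (A × A),
    (∀ n, IsLOCC (Λ n) ∧ 0 < (Λ n ρ).trace.re) ∧
    Tendsto (fun n => (Λ n ρ).trace.re) atTop (𝓝 0) ∧
    Tendsto (fun n => singletFraction (((Λ n ρ).trace)⁻¹ • Λ n ρ)) atTop (𝓝 1)

/-! ### The example -/

/-- The two-qubit basis vector `|ij⟩`. -/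
def ket (i j : Fin 2) : Fin 2 × Fin 2 → ℂ := Pi.single (i, j) 1

/-- The state `b/(a+b) |Ψ⟩⟨Ψ| + a/(a+b) |01⟩⟨01|` with `Ψ = a|00⟩ + b|11⟩`. -/
noncomputable def exampleState (a b : ℝ) : Matrix (Fin 2 × Fin 2) (Fin 2 × Fin 2) ℂ :=
  ((b / (a + b) : ℝ) : ℂ) • ketbra ((a : ℂ) • ket 0 0 + (b : ℂ) • ket 1 1) +
    ((a / (a + b) : ℝ) : ℂ) • ketbra (ket 0 1)

end ProbQEC

namespace ProbQEC

open Matrix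

variable {A B R S ι : Type*}

/-! ### Kraus maps and Choi matrices -/

/-! Everything reduces to Kraus operators. If `D ∘ Θ ∘ E = p · id`, every product `L K M` of Kraus
operators of `D`, `Θ`, `E` is a scalar matrix (`exists_eq_smul_one_of_krausMap_eq`), and some
product is nonzero because `p > 0`. Two obstructions follow.

Full-rank obstruction: if the Choi matrix dominates `c • 1` with `c > 0`, all rank-one operators
`|b⟩⟨a|` may be taken among the Kraus operators, up to a factor. Then `L |b⟩⟨a| M` has rank at most
one and is scalar in dimension at least two, so it vanishes. By linearity `L K M = 0` for every `K`,
a contradiction. The Choi states form a bounded convex body with interior in their affine space, and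
each interior point dominates a multiple of the identity. Correctable channels therefore lie on the
frontier of a convex set, which is Haar-null.

Singular obstruction: for a channel from `A` to `A`, a nonzero scalar `L K M` makes `L` and `M`
invertible, so every nonzero Kraus operator of `Θ` must be invertible. Amplitude damping violates
this through its jump `|1⟩⟨0|`, and so do its tensor powers.

Damping is nevertheless quasi-correctable. Let the sender attenuate `|0⟩` and the receiver `|1⟩` by
factors of order `x`. The no-jump operator picks up one factor `x` and becomes proportional to the
identity, while the jump picks up two and is negligible as `x → 0`. The same mechanism quasidistills
`exampleState`, which is the Choi state of a damping channel up to a diagonal filter. Bit flips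
supply the perfectly correctable local errors, being their own inverses. -/

/-- The completely positive map `X ↦ ∑ s, K s X (K s)†`. -/
def krausMap [Fintype S] [Fintype A] (K : S → Matrix B A ℂ) : SuperOp A B where
  toFun X := ∑ s, K s * X * (K s)ᴴ
  map_add' X Y := by simp [Matrix.mul_add, Matrix.add_mul, Finset.sum_add_distrib]
  map_smul' c X := by simp [Finset.smul_sum]

theorem krausMap_apply [Fintype S] [Fintype A] (K : S → Matrix B A ℂ) (X : Matrix A A ℂ) :
    krausMap K X = ∑ s, K s * X * (K s)ᴴ := rfl

open scoped MatrixOrder in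
theorem exists_eq_conjTranspose_mul_self {I : Type*} [Fintype I] {X : Matrix I I ℂ}
    (hX : X.PosSemidef) : ∃ Y : Matrix I I ℂ, X = Yᴴ * Y := by
  classical
  obtain ⟨Y, hY, -, h⟩ := CFC.exists_sqrt_of_isSelfAdjoint_of_quasispectrumRestricts
    hX.isHermitian (QuasispectrumRestricts.nnreal_of_nonneg hX.nonneg)
  exact ⟨Y, by rw [← h]; exact congrArg (· * Y) hY.star_eq.symm⟩

theorem onSecond_krausMap [Fintype S] [Fintype A] [Fintype R] [DecidableEq R]
    (K : S → Matrix B A ℂ) (X : Matrix (R × A) (R × A) ℂ) :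
    onSecond (krausMap K) X =
      ∑ s, ((1 : Matrix R R ℂ) ⊗ₖ K s) * X * ((1 : Matrix R R ℂ) ⊗ₖ K s)ᴴ := by
  ext x y
  simp [onSecond, krausMap_apply, Matrix.sum_apply, Matrix.mul_apply, Matrix.one_apply,
    Fintype.sum_prod_type, ite_mul, Finset.sum_ite_irrel, Finset.sum_ite_eq, apply_ite]

theorem isCP_krausMap [Fintype S] [Fintype A] [Finite B] (K : S → Matrix B A ℂ) : IsCP (krausMap K) := by
  intro k X hX
  rw [onSecond_krausMap]
  exact posSemidef_sum _ fun s _ => hX.mul_mul_conjTranspose_same _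

theorem trace_krausMap [Fintype S] [Fintype A] [Fintype B] (K : S → Matrix B A ℂ)
    (X : Matrix A A ℂ) : (krausMap K X).trace = ((∑ s, (K s)ᴴ * K s) * X).trace := by
  rw [krausMap_apply, trace_sum, Matrix.sum_mul, trace_sum]
  exact Finset.sum_congr rfl fun s _ => by rw [Matrix.trace_mul_comm, Matrix.mul_assoc]

/-- The channel with Kraus operators `K s`. -/
def krausChannel [Fintype S] [Fintype A] [DecidableEq A] [Fintype B] (K : S → Matrix B A ℂ)
    (hK : ∑ s, (K s)ᴴ * K s = 1) : QChannel A B :=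
  ⟨krausMap K, isCP_krausMap K, fun X => by rw [trace_krausMap, hK, one_mul]⟩

/-- The unnormalized Choi matrix `∑ a a', |a⟩⟨a'| ⊗ Φ(|a⟩⟨a'|)`. -/
def choiMatrix [DecidableEq A] (Φ : SuperOp A B) : Matrix (A × B) (A × B) ℂ :=
  Matrix.of fun x y => Φ (Matrix.single x.1 y.1 1) x.2 y.2

theorem choiMatrix_injective [Fintype A] [DecidableEq A] :
    Function.Injective (choiMatrix : SuperOp A B → Matrix (A × B) (A × B) ℂ) := by
  intro Φ Ψ h
  refine Matrix.ext_linearMap _ fun a a' => LinearMap.ext_ring ?_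
  ext b b'
  simpa [choiMatrix] using congrFun (congrFun h (a, b)) (a', b')

theorem choiMatrix_krausMap [Fintype S] [Fintype A] [DecidableEq A] (K : S → Matrix B A ℂ)
    (x y : A × B) : choiMatrix (krausMap K) x y = ∑ s, K s x.2 x.1 * star (K s y.2 y.1) := by
  simp [choiMatrix, krausMap_apply, Matrix.sum_apply, Matrix.mul_apply, Matrix.single_apply,
    ite_and]

/-- Factor `J = Cᴴ * C`; the conjugated rows of `C`, reshaped into matrices, are the Kraus
operators. -/
theorem exists_choiMatrix_krausMap_eq [Fintype A] [DecidableEq A] [Fintype B] 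
    {J : Matrix (A × B) (A × B) ℂ} (hJ : J.PosSemidef) :
    ∃ K : A × B → Matrix B A ℂ, choiMatrix (krausMap K) = J := by
  classical
  obtain ⟨C, rfl⟩ := exists_eq_conjTranspose_mul_self hJ
  refine ⟨fun s => Matrix.of fun b a => star (C s (a, b)), ?_⟩
  ext x y
  simp [choiMatrix_krausMap, Matrix.mul_apply]

/-- The Choi matrix is the image of the unnormalized maximally entangled projector. Since `IsCP`
speaks only of ancillas `Fin k`, the reference copy of `A` is relabelled by `Fin (card A)` and
relabelled back by `submatrix`. -/
theorem IsCP.posSemidef_choiMatrix [Fintype A] [DecidableEq A] [Fintype B] {Φ : SuperOp A B}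
    (h : IsCP Φ) : (choiMatrix Φ).PosSemidef := by
  let e := Fintype.equivFin A
  let v : Fin (Fintype.card A) × A → ℂ := fun x => if e.symm x.1 = x.2 then 1 else 0
  have := (h _ _ (posSemidef_vecMulVec_self_star v)).submatrix (Prod.map e id)
  convert this using 1
  ext x y
  simp only [choiMatrix, onSecond, submatrix_apply, of_apply, Prod.map_fst, Prod.map_snd, id]
  refine congrArg (fun Y => Φ Y x.2 y.2) ?_
  ext a a'
  by_cases h1 : x.1 = a <;> by_cases h2 : y.1 = a' <;>
    simp [v, vecMulVec_apply, Matrix.single, h1, h2]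

theorem IsCP.exists_eq_krausMap [Fintype A] [DecidableEq A] [Fintype B] {Φ : SuperOp A B}
    (h : IsCP Φ) : ∃ K : A × B → Matrix B A ℂ, Φ = krausMap K := by
  obtain ⟨K, hK⟩ := exists_choiMatrix_krausMap_eq h.posSemidef_choiMatrix
  exact ⟨K, choiMatrix_injective hK.symm⟩

theorem choiState_eq [Fintype A] [DecidableEq A] (Φ : SuperOp A B) :
    choiState Φ = (Fintype.card A : ℂ)⁻¹ • choiMatrix Φ := by
  ext x y
  have h : (Matrix.of fun a a' => ketbra (psiPlus A) (x.1, a) (y.1, a')) =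
      (Fintype.card A : ℂ)⁻¹ • Matrix.single x.1 y.1 1 := by
    ext a a'
    have hc : ((Real.sqrt (Fintype.card A) : ℂ))⁻¹ * ((Real.sqrt (Fintype.card A) : ℂ))⁻¹ =
        (Fintype.card A : ℂ)⁻¹ := by
      rw [← mul_inv, ← Complex.ofReal_mul, Real.mul_self_sqrt (Nat.cast_nonneg _)]
      simp
    by_cases h1 : x.1 = a <;> by_cases h2 : y.1 = a' <;>
      simp [ketbra, psiPlus, vecMulVec_apply, h1, h2, hc]
  simp only [choiState, onSecond, of_apply, h, map_smul, Matrix.smul_apply, choiMatrix]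

/-! ### Necessary conditions for perfect correction -/

/-- For `w ⟂ v`, evaluating the identity at `|v⟩⟨v|` and sandwiching it with `w` gives `∑ s, |⟨w, L
s v⟩|² = 0`. So each `L s` preserves orthogonality of such pairs, which forces it to be scalar. -/
theorem exists_eq_smul_one_of_krausMap_eq [Fintype S] [Fintype A] [DecidableEq A] [Nonempty A]
    {L : S → Matrix A A ℂ} {c : ℂ} (h : ∀ X, krausMap L X = c • X) (s : S) :
    ∃ z : ℂ, L s = z • (1 : Matrix A A ℂ) := by
  have key : ∀ v w : A → ℂ, star w ⬝ᵥ v = 0 → star w ⬝ᵥ (L s *ᵥ v) = 0 := by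
    intro v w hvw
    have h1 := congrArg (fun Y => star w ⬝ᵥ (Y *ᵥ w)) (h (vecMulVec v (star v)))
    have h2 : ∀ t, star w ⬝ᵥ ((L t * vecMulVec v (star v) * (L t)ᴴ) *ᵥ w) =
        ((‖star w ⬝ᵥ (L t *ᵥ v)‖ ^ 2 : ℝ) : ℂ) := by
      intro t
      rw [Matrix.mul_vecMulVec, Matrix.vecMulVec_mul, ← Matrix.star_mulVec,
        Matrix.vecMulVec_mulVec]
      simp only [dotProduct_smul, MulOpposite.smul_eq_mul_unop, MulOpposite.unop_op]
      rw [show star (L t *ᵥ v) ⬝ᵥ w = star (star w ⬝ᵥ (L t *ᵥ v)) by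
        rw [Matrix.star_dotProduct], Complex.star_def, Complex.mul_conj, Complex.normSq_eq_norm_sq]
    simp only [krausMap_apply, Matrix.sum_mulVec, dotProduct_sum, h2, smul_mulVec,
      Matrix.vecMulVec_mulVec, dotProduct_smul, hvw, smul_zero] at h1
    rw [← Complex.ofReal_sum, Complex.ofReal_eq_zero,
      Finset.sum_eq_zero_iff_of_nonneg fun _ _ => sq_nonneg _] at h1
    simpa using h1 s (Finset.mem_univ s)
  have off : ∀ i j, i ≠ j → L s i j = 0 := by
    intro i j hij
    simpa using key (Pi.single j 1) (Pi.single i 1) (by simp [hij])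
  have diag : ∀ i j, L s i i = L s j j := by
    intro i j
    rcases eq_or_ne i j with rfl | hij
    · rfl
    -- With vanishing off-diagonal entries, the orthogonal pair `e_i ± e_j` compares the two
    -- diagonal entries.
    have := key (Pi.single i 1 + Pi.single j 1) (Pi.single i 1 - Pi.single j 1)
      (by simp [hij, hij.symm])
    simpa [Matrix.mulVec_add, off i j hij, off j i hij.symm, add_neg_eq_zero] using this
  refine ⟨L s (Classical.arbitrary A) (Classical.arbitrary A), ?_⟩
  ext i j
  rcases eq_or_ne i j with rfl | hij
  · simpa using diag _ _
  · simp [off i j hij, hij]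

/-- If a channel with Kraus operators `K s` allows perfect correction, then some filters `L` of the
receiver and `M` of the sender turn all Kraus operators into scalars, not all of them zero. -/
theorem AllowsPerfectCorrectionWithCoding.exists_filters [Fintype S] [Fintype A] [DecidableEq A]
    [Nonempty A] [Fintype B] {K : S → Matrix B A ℂ}
    (h : AllowsPerfectCorrectionWithCoding (krausMap K)) :
    ∃ (L : Matrix A B ℂ) (M : Matrix A A ℂ),
      (∀ s, ∃ z : ℂ, L * K s * M = z • (1 : Matrix A A ℂ)) ∧ ∃ s, L * K s * M ≠ 0 := by
  classical
  obtain ⟨E, D, p, hE, hD, hp, h⟩ := h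
  obtain ⟨E, rfl⟩ := hE.1.exists_eq_krausMap
  obtain ⟨D, rfl⟩ := hD.1.exists_eq_krausMap
  -- The composite is itself a Kraus map, indexed by triples; fixing the outer indices of one
  -- nonzero product provides `L` and `M`.
  have h' : ∀ X, krausMap (fun t : (B × A) × S × (A × A) => D t.1 * K t.2.1 * E t.2.2) X =
      (p : ℂ) • X := by
    intro X
    rw [← h X]
    simp only [krausMap_apply, Matrix.mul_sum, Matrix.sum_mul, Fintype.sum_prod_type,
      conjTranspose_mul, Matrix.mul_assoc]
  have hne : ∃ t : (B × A) × S × (A × A), D t.1 * K t.2.1 * E t.2.2 ≠ 0 := by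
    by_contra! h0
    have h1 := h' 1
    simp only [krausMap_apply, h0, Matrix.zero_mul, Finset.sum_const_zero] at h1
    have h2 := congrFun (congrFun h1 (Classical.arbitrary A)) (Classical.arbitrary A)
    exact hp.ne (Complex.ofReal_injective (by simpa using h2))
  obtain ⟨t, ht⟩ := hne
  exact ⟨D t.1, E t.2.2, fun s => exists_eq_smul_one_of_krausMap_eq h' (t.1, s, t.2.2), t.2.1, ht⟩

/-- A principal 2×2 minor of a rank-one matrix vanishes, while that of `z • 1` equals `z²`. -/
theorem vecMulVec_eq_zero_of_eq_smul_one [DecidableEq A] [Nontrivial A] {u w : A → ℂ} {z : ℂ}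
    (h : vecMulVec u w = z • (1 : Matrix A A ℂ)) : vecMulVec u w = 0 := by
  obtain ⟨i, j, hij⟩ := exists_pair_ne A
  have e := fun k l => congrFun (congrFun h k) l
  have hii := e i i
  have hjj := e j j
  have h1 := e i j
  simp only [vecMulVec_apply, Matrix.smul_apply, one_apply_eq, one_apply_ne hij, smul_eq_mul,
    mul_one, mul_zero] at hii hjj h1
  have : z * z = 0 := by
    calc z * z = (u i * w i) * (u j * w j) := by rw [hii, hjj]
      _ = (u i * w j) * (u j * w i) := by ring
      _ = 0 := by rw [h1, zero_mul]
  rw [h, mul_self_eq_zero.1 this, zero_smul]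

/-- A channel whose Choi matrix dominates a positive multiple of the identity admits no perfect
correction. -/
theorem not_allowsPerfectCorrectionWithCoding_of_posSemidef_sub [Fintype A] [DecidableEq A]
    [Nontrivial A] [Fintype B] [DecidableEq B] {Φ : SuperOp A B} {c : ℝ} (hc : 0 < c)
    (h : (choiMatrix Φ - (c : ℂ) • 1).PosSemidef) : ¬ AllowsPerfectCorrectionWithCoding Φ := by
  obtain ⟨K, hK⟩ := exists_choiMatrix_krausMap_eq h
  -- Kraus operators for the remainder, followed by `√c |b⟩⟨a|`, whose joint Choi matrix is `c • 1`.
  let K' : (A × B) ⊕ (A × B) → Matrix B A ℂ :=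
    Sum.elim K fun s => ((Real.sqrt c : ℝ) : ℂ) • vecMulVec (Pi.single s.2 1) (Pi.single s.1 1)
  have hcc : ((Real.sqrt c : ℝ) : ℂ) * ((Real.sqrt c : ℝ) : ℂ) = c := by
    rw [← Complex.ofReal_mul, Real.mul_self_sqrt hc.le]
  have hΦ : Φ = krausMap K' := by
    apply choiMatrix_injective
    rw [← eq_sub_iff_add_eq.1 hK]
    ext ⟨a, b⟩ ⟨a', b'⟩
    rw [Matrix.add_apply, choiMatrix_krausMap, choiMatrix_krausMap, Fintype.sum_sum_type]
    congr 1
    rcases eq_or_ne a a' with rfl | h1 <;> rcases eq_or_ne b b' with rfl | h2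
    · simp [K', Fintype.sum_prod_type, vecMulVec_apply, Pi.single_apply, hcc]
    all_goals simp [K', Fintype.sum_prod_type, vecMulVec_apply, Pi.single_apply, *, Ne.symm]
  rw [hΦ]
  intro hcorr
  obtain ⟨L, M, hLM, s, hs⟩ := hcorr.exists_filters
  have hz : ∀ (b : B) (a : A),
      L * vecMulVec (Pi.single b (1 : ℂ)) (Pi.single a (1 : ℂ)) * M = 0 := by
    intro b a
    obtain ⟨z, hz⟩ := hLM (Sum.inr (a, b))
    have hs0 : ((Real.sqrt c : ℝ) : ℂ) ≠ 0 := by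
      simpa using (Real.sqrt_pos.2 hc).ne'
    have hz' : L * vecMulVec (Pi.single b (1 : ℂ)) (Pi.single a (1 : ℂ)) * M =
        (((Real.sqrt c : ℝ) : ℂ)⁻¹ * z) • (1 : Matrix A A ℂ) := by
      rw [mul_smul, ← hz]
      simp only [K', Sum.elim_inr, Matrix.mul_smul, Matrix.smul_mul]
      rw [inv_smul_smul₀ hs0]
    rw [Matrix.mul_vecMulVec, Matrix.vecMulVec_mul] at hz' ⊢
    exact vecMulVec_eq_zero_of_eq_smul_one hz'
  apply hs
  -- The operators `|b⟩⟨a|` span, so `L * K' s * M` vanishes even for the `s` where it was supposed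
  -- nonzero.
  rw [show K' s = ∑ b, ∑ a, K' s b a • vecMulVec (Pi.single b 1) (Pi.single a 1) by
    ext b a
    simp [Matrix.sum_apply, vecMulVec_apply, Pi.single_apply]]
  simp [Matrix.mul_sum, Matrix.sum_mul, hz]

/-! ### The convex body of Choi states -/

theorem trace_single_one [Fintype A] [DecidableEq A] (a a' : A) :
    (Matrix.single a a' (1 : ℂ)).trace = (1 : Matrix A A ℂ) a a' := by
  rcases eq_or_ne a a' with rfl | h
  · simp
  · simp [h]

theorem isHermitian_ofReal_smul_one {I : Type*} [DecidableEq I] (r : ℝ) :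
    ((r : ℂ) • (1 : Matrix I I ℂ)).IsHermitian := by
  rw [IsHermitian, conjTranspose_smul, conjTranspose_one, Complex.star_def, Complex.conj_ofReal]

theorem traceSecond_choiState [Fintype A] [DecidableEq A] [Fintype B] (Θ : QChannel A B) :
    traceSecond (choiState Θ.1) = (Fintype.card A : ℂ)⁻¹ • 1 := by
  ext a a'
  have := Θ.2.2 (Matrix.single a a' 1)
  rw [trace_single_one] at this
  rw [choiState_eq, Matrix.smul_apply, ← this]
  simp [traceSecond, choiMatrix, Matrix.trace, Finset.mul_sum]

theorem posSemidef_choiState [Fintype A] [DecidableEq A] [Fintype B] (Θ : QChannel A B) :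
    (choiState Θ.1).PosSemidef := by
  rw [choiState_eq]
  exact Θ.2.1.posSemidef_choiMatrix.smul (by positivity)

/-- The marginal condition is trace preservation tested on matrix units. -/
theorem exists_choiState_eq [Fintype A] [DecidableEq A] [Nonempty A] [Fintype B]
    {X : Matrix (A × B) (A × B) ℂ} (hX : X.PosSemidef)
    (hX' : traceSecond X = (Fintype.card A : ℂ)⁻¹ • 1) :
    ∃ Θ : QChannel A B, choiState Θ.1 = X := by
  have hd : (Fintype.card A : ℂ) ≠ 0 := by simp
  obtain ⟨K, hK⟩ := exists_choiMatrix_krausMap_eq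
    (hX.smul (show (0 : ℂ) ≤ (Fintype.card A : ℂ) by positivity))
  have htr : Matrix.traceLinearMap B ℂ ℂ ∘ₗ krausMap K = Matrix.traceLinearMap A ℂ ℂ := by
    refine Matrix.ext_linearMap _ fun a a' => LinearMap.ext_ring ?_
    have h := congrFun (congrFun hX' a) a'
    have h' : ∀ b, krausMap K (Matrix.single a a' 1) b b =
        (Fintype.card A : ℂ) * X (a, b) (a', b) := fun b =>
      congrFun (congrFun hK (a, b)) (a', b)
    simp only [traceSecond, of_apply] at h
    change (krausMap K (Matrix.single a a' 1)).trace = (Matrix.single a a' (1 : ℂ)).trace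
    rw [trace_single_one, Matrix.trace]
    simp only [diag_apply, h', ← Finset.mul_sum, h, Matrix.smul_apply, smul_eq_mul]
    rw [mul_inv_cancel_left₀ hd]
  refine ⟨⟨krausMap K, isCP_krausMap K, fun X => congrFun (congrArg DFunLike.coe htr) X⟩, ?_⟩
  rw [choiState_eq, hK, inv_smul_smul₀ hd]

theorem norm_apply_le_of_posSemidef {I : Type*} [Fintype I] {X : Matrix I I ℂ}
    (hX : X.PosSemidef) (i j : I) : ‖X i j‖ ≤ X.trace.re := by
  obtain ⟨Y, rfl⟩ := exists_eq_conjTranspose_mul_self hX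
  have hd : ∀ k, ((Yᴴ * Y) k k).re = ∑ l, ‖Y l k‖ ^ 2 := by
    intro k
    simp [Matrix.mul_apply, ← Complex.normSq_eq_conj_mul_self, Complex.normSq_eq_norm_sq,
      -Complex.ofReal_pow]
  have htr : ∀ k, ∑ l, ‖Y l k‖ ^ 2 ≤ (Yᴴ * Y).trace.re := by
    intro k
    rw [Matrix.trace, Complex.re_sum]
    simp only [diag_apply, hd]
    exact Finset.single_le_sum (f := fun k => ∑ l, ‖Y l k‖ ^ 2)
      (fun k _ => Finset.sum_nonneg fun _ _ => sq_nonneg _) (Finset.mem_univ k)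
  calc ‖(Yᴴ * Y) i j‖ ≤ ∑ l, ‖Y l i‖ * ‖Y l j‖ := by
        rw [Matrix.mul_apply]
        refine (norm_sum_le _ _).trans_eq ?_
        simp
    _ ≤ ∑ l, (‖Y l i‖ ^ 2 + ‖Y l j‖ ^ 2) / 2 :=
        Finset.sum_le_sum fun l _ => by nlinarith [sq_nonneg (‖Y l i‖ - ‖Y l j‖)]
    _ = (∑ l, ‖Y l i‖ ^ 2 + ∑ l, ‖Y l j‖ ^ 2) / 2 := by
        rw [← Finset.sum_div, Finset.sum_add_distrib]
    _ ≤ _ := by linarith [htr i, htr j]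

theorem posSemidef_smul_one_add {I : Type*} [Fintype I] [DecidableEq I] {X : Matrix I I ℂ}
    (hX : X.IsHermitian) {r : ℝ} (hr : ∀ i j, ‖X i j‖ ≤ r) :
    (((Fintype.card I * r : ℝ) : ℂ) • (1 : Matrix I I ℂ) + X).PosSemidef := by
  have hH : (((Fintype.card I * r : ℝ) : ℂ) • (1 : Matrix I I ℂ) + X).IsHermitian :=
    (isHermitian_ofReal_smul_one _).add hX
  refine PosSemidef.of_dotProduct_mulVec_nonneg hH fun v => ?_
  rw [Complex.le_def]
  refine ⟨?_, ?_⟩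
  swap
  · exact (hH.im_star_dotProduct_mulVec_self v).symm
  have h1 : ‖star v ⬝ᵥ (X *ᵥ v)‖ ≤ Fintype.card I * r * ∑ i, ‖v i‖ ^ 2 := by
    calc ‖star v ⬝ᵥ (X *ᵥ v)‖ ≤ ∑ i, ∑ j, ‖v i‖ * (r * ‖v j‖) := by
          simp only [dotProduct, mulVec, Finset.mul_sum]
          refine (norm_sum_le _ _).trans (Finset.sum_le_sum fun i _ => ?_)
          refine (norm_sum_le _ _).trans (Finset.sum_le_sum fun j _ => ?_)
          simp only [norm_mul, Pi.star_apply, norm_star]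
          gcongr
          exact hr i j
      _ ≤ ∑ i, ∑ j, r * ((‖v i‖ ^ 2 + ‖v j‖ ^ 2) / 2) := by
          refine Finset.sum_le_sum fun i _ => Finset.sum_le_sum fun j _ => ?_
          have : 0 ≤ r := (norm_nonneg _).trans (hr i i)
          nlinarith [mul_nonneg this (sq_nonneg (‖v i‖ - ‖v j‖))]
      _ = _ := by
          simp only [← Finset.mul_sum, ← Finset.sum_div, Finset.sum_add_distrib,
            Finset.sum_const, Finset.card_univ, nsmul_eq_mul]
          ring
  have h2 : star v ⬝ᵥ v = ((∑ i, ‖v i‖ ^ 2 : ℝ) : ℂ) := by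
    simp [dotProduct, ← Complex.normSq_eq_conj_mul_self, Complex.normSq_eq_norm_sq]
  rw [Matrix.add_mulVec, dotProduct_add, smul_mulVec, one_mulVec, dotProduct_smul, h2,
    smul_eq_mul, ← Complex.ofReal_mul, Complex.add_re, Complex.ofReal_re, Complex.zero_re]
  linarith [(abs_le.1 (Complex.abs_re_le_norm (star v ⬝ᵥ (X *ᵥ v)))).1]

/-- `hsVector` as a real linear equivalence. -/
noncomputable def hsEquiv (I : Type*) [Fintype I] : Matrix I I ℂ ≃ₗ[ℝ] EuclideanSpace ℂ (I × I) where
  toFun := hsVector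
  invFun w := Matrix.of fun i j => w (i, j)
  left_inv _ := rfl
  right_inv _ := rfl
  map_add' _ _ := rfl
  map_smul' _ _ := rfl

theorem hsEquiv_symm_apply {I : Type*} [Fintype I] (w : EuclideanSpace ℂ (I × I)) (i j : I) :
    (hsEquiv I).symm w i j = w (i, j) := rfl

/-- The space `choiDirection A B` as a subspace of the Hilbert–Schmidt Euclidean space. -/
noncomputable def hsDirection (A B : Type*) [Fintype A] [Fintype B] :
    Submodule ℝ (EuclideanSpace ℂ ((A × B) × (A × B))) :=
  (choiDirection A B).map (hsEquiv (A × B)).toLinearMap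

theorem hsEquiv_symm_mem [Fintype A] [Fintype B] (w : hsDirection A B) :
    (hsEquiv (A × B)).symm w ∈ choiDirection A B := by
  obtain ⟨X, hX, h⟩ := w.2
  rw [← h]
  simpa using hX

/-- The maximally mixed state. -/
noncomputable def maxMixed (I : Type*) [Fintype I] [DecidableEq I] : Matrix I I ℂ :=
  (Fintype.card I : ℂ)⁻¹ • 1

theorem traceSecond_add [Fintype B] (X Y : Matrix (A × B) (A × B) ℂ) :
    traceSecond (X + Y) = traceSecond X + traceSecond Y := by
  ext a a'; simp [traceSecond, Finset.sum_add_distrib]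

theorem trace_traceSecond [Fintype A] [Fintype B] (X : Matrix (A × B) (A × B) ℂ) :
    (traceSecond X).trace = X.trace := by
  simp [traceSecond, Matrix.trace, Fintype.sum_prod_type]

theorem traceSecond_maxMixed [Fintype A] [DecidableEq A] [Fintype B] [DecidableEq B] [Nonempty B] :
    traceSecond (maxMixed (A × B)) = (Fintype.card A : ℂ)⁻¹ • 1 := by
  ext a a'
  have hB : (Fintype.card B : ℂ) ≠ 0 := by simp
  by_cases h : a = a' <;> simp [traceSecond, maxMixed, Matrix.one_apply, h]

/-- The Choi states of channels, relative to the maximally mixed state. -/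
def choiBody (A B : Type*) [Fintype A] [DecidableEq A] [Fintype B] [DecidableEq B] :
    Set (hsDirection A B) :=
  {w | (maxMixed (A × B) + (hsEquiv (A × B)).symm w).PosSemidef}

/-- Translation by the maximally mixed state embeds `hsDirection` isometrically, and Euclidean
Hausdorff measure is invariant under isometries. The gain is that on `hsDirection` the measure has
full dimension, so it is a Haar measure. -/
theorem channelVolume_eq [Fintype A] [DecidableEq A] [Fintype B] [DecidableEq B] [Nonempty B]
    (S : Set (QChannel A B)) :
    channelVolume S = (MeasureTheory.Measure.euclideanHausdorffMeasure
      (Module.finrank ℝ (hsDirection A B)) : MeasureTheory.Measure (hsDirection A B))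
      {w | ∃ Θ ∈ S, choiState Θ.1 = maxMixed (A × B) + (hsEquiv (A × B)).symm w} := by
  have hiso : Isometry fun w : hsDirection A B =>
      hsVector (maxMixed (A × B)) + (w : EuclideanSpace ℂ ((A × B) × (A × B))) :=
    (isometry_add_left _).comp isometry_subtype_coe
  rw [← hiso.euclideanHausdorffMeasure_image, channelVolume, hsDirection,
    LinearEquiv.finrank_map_eq]
  congr 1
  ext y
  constructor
  · rintro ⟨Θ, hΘ, rfl⟩
    have hmem : choiState Θ.1 - maxMixed (A × B) ∈ choiDirection A B := by
      refine ⟨(posSemidef_choiState Θ).isHermitian.sub ?_, ?_⟩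
      · simpa [maxMixed] using
          isHermitian_ofReal_smul_one (I := A × B) (Fintype.card (A × B) : ℝ)⁻¹
      · have h := traceSecond_add (choiState Θ.1 - maxMixed (A × B)) (maxMixed (A × B))
        rw [sub_add_cancel, traceSecond_choiState, traceSecond_maxMixed] at h
        exact right_eq_add.1 h
    refine ⟨⟨hsEquiv (A × B) _, Submodule.mem_map_of_mem hmem⟩, ⟨Θ, hΘ, ?_⟩, ?_⟩
    · simp
    · change hsEquiv _ _ + hsEquiv _ _ = hsEquiv _ _
      rw [← map_add, add_sub_cancel]
  · rintro ⟨w, ⟨Θ, hΘ, h⟩, rfl⟩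
    refine ⟨Θ, hΘ, ?_⟩
    change hsEquiv _ _ = hsEquiv _ _ + (w : EuclideanSpace ℂ ((A × B) × (A × B)))
    rw [h, map_add, LinearEquiv.apply_symm_apply]

theorem setOf_exists_choiState_eq_choiBody [Fintype A] [DecidableEq A] [Nonempty A] [Fintype B]
    [DecidableEq B] [Nonempty B] :
    {w : hsDirection A B | ∃ Θ ∈ (Set.univ : Set (QChannel A B)),
      choiState Θ.1 = maxMixed (A × B) + (hsEquiv (A × B)).symm w} = choiBody A B := by
  ext w
  constructor
  · rintro ⟨Θ, -, h⟩
    exact (congrArg PosSemidef h).mp (posSemidef_choiState Θ)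
  · intro hw
    obtain ⟨Θ, hΘ⟩ := exists_choiState_eq hw (by
      rw [traceSecond_add, (hsEquiv_symm_mem w).2, add_zero, traceSecond_maxMixed])
    exact ⟨Θ, trivial, hΘ⟩

theorem convex_choiBody [Fintype A] [DecidableEq A] [Fintype B] [DecidableEq B] :
    Convex ℝ (choiBody A B) := by
  intro x hx y hy s t hs ht hst
  have h := (hx.smul hs).add (hy.smul ht)
  change (maxMixed (A × B) + (hsEquiv (A × B)).symm
    (s • (x : EuclideanSpace ℂ ((A × B) × (A × B))) + t • y)).PosSemidef
  convert h using 1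
  simp only [map_add, map_smul, smul_add]
  rw [add_add_add_comm, ← add_smul, hst, one_smul]

theorem isBounded_choiBody [Fintype A] [DecidableEq A] [Fintype B] [DecidableEq B] [Nonempty A]
    [Nonempty B] : Bornology.IsBounded (choiBody A B) := by
  rw [isBounded_iff_forall_norm_le]
  -- Each entry of `w` is a difference of entries of two trace-one positive matrices, each of
  -- modulus at most 1; hence the 2.
  refine ⟨Real.sqrt (∑ _i : (A × B) × (A × B), 2 ^ 2), fun w hw => Real.le_sqrt_of_sq_le ?_⟩
  have htr : (maxMixed (A × B) + (hsEquiv (A × B)).symm w).trace = 1 := by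
    have h := traceSecond_add (maxMixed (A × B)) ((hsEquiv (A × B)).symm w)
    rw [(hsEquiv_symm_mem w).2, add_zero, traceSecond_maxMixed] at h
    have h' := congrArg Matrix.trace h
    rw [trace_traceSecond] at h'
    simpa using h'
  have hmm : (maxMixed (A × B)).trace = 1 := by
    rw [maxMixed, trace_smul, trace_one, smul_eq_mul, inv_mul_cancel₀ (by simp)]
  have hmp : (maxMixed (A × B)).PosSemidef := PosSemidef.one.smul (by positivity)
  rw [Submodule.coe_norm, EuclideanSpace.norm_sq_eq]
  refine Finset.sum_le_sum fun i _ => pow_le_pow_left₀ (norm_nonneg _) ?_ 2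
  have h1 := norm_apply_le_of_posSemidef hw i.1 i.2
  have h2 := norm_apply_le_of_posSemidef hmp i.1 i.2
  rw [htr] at h1
  rw [hmm] at h2
  have h3 := norm_sub_le ((maxMixed (A × B) + (hsEquiv (A × B)).symm w) i.1 i.2)
    (maxMixed (A × B) i.1 i.2)
  rw [Matrix.add_apply, add_sub_cancel_left, hsEquiv_symm_apply] at h3
  rw [Matrix.add_apply, hsEquiv_symm_apply] at h1
  simp only [Complex.one_re] at h1 h2
  linarith

theorem choiBody_mem_nhds_zero [Fintype A] [DecidableEq A] [Fintype B] [DecidableEq B] [Nonempty A]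
    [Nonempty B] : choiBody A B ∈ 𝓝 0 := by
  have hN : (0 : ℝ) < Fintype.card (A × B) := by exact_mod_cast Fintype.card_pos
  -- With `N = card (A × B)`, entries bounded by `N⁻²` give a quadratic form bounded by `N · N⁻² =
  -- N⁻¹`, the eigenvalue of the maximally mixed state.
  refine Metric.mem_nhds_iff.2 ⟨(Fintype.card (A × B) : ℝ)⁻¹ ^ 2, by positivity, fun w hw => ?_⟩
  have h := posSemidef_smul_one_add (hsEquiv_symm_mem w).1 (r := (Fintype.card (A × B) : ℝ)⁻¹ ^ 2)
    fun i j => by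
      rw [hsEquiv_symm_apply]
      refine (PiLp.norm_apply_le (w : EuclideanSpace ℂ ((A × B) × (A × B))) (i, j)).trans ?_
      simpa using (mem_ball_zero_iff.1 hw).le
  change (maxMixed (A × B) + _).PosSemidef
  convert h using 2
  rw [sq, mul_inv_cancel_left₀ hN.ne', maxMixed, Complex.ofReal_inv, Complex.ofReal_natCast]

/-- An interior point can be pushed slightly outwards to `(1 + t) • w`, still in the body. Hence the
Choi state is a convex combination of a positive operator and the maximally mixed state, the latter
with weight `t / (1 + t) > 0`. -/
theorem not_allowsPerfectCorrectionWithCoding_of_mem_interior [Fintype A] [DecidableEq A]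
    [Nontrivial A] [Fintype B] [DecidableEq B] [Nonempty B] {w : hsDirection A B}
    (hw : w ∈ interior (choiBody A B)) {Θ : QChannel A B}
    (h : choiState Θ.1 = maxMixed (A × B) + (hsEquiv (A × B)).symm w) :
    ¬ AllowsPerfectCorrectionWithCoding Θ.1 := by
  have hA : (Fintype.card A : ℂ) ≠ 0 := by simp
  have hcont : Tendsto (fun t : ℝ => (1 + t) • w) (𝓝[>] 0) (𝓝 w) := by
    have : Continuous fun t : ℝ => (1 + t) • w := by fun_prop
    simpa using (this.tendsto 0).mono_left nhdsWithin_le_nhds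
  obtain ⟨t, ht, ht0⟩ := ((hcont.eventually (mem_interior_iff_mem_nhds.1 hw)).and
    self_mem_nhdsWithin).exists
  have ht0 : 0 < t := ht0
  have hB : (0 : ℝ) < Fintype.card B := by exact_mod_cast Fintype.card_pos
  refine not_allowsPerfectCorrectionWithCoding_of_posSemidef_sub
    -- The weight `t / (1 + t)` times `d_A / (d_A d_B)`, as the Choi matrix is `d_A` times the Choi
    -- state.
    (c := t / ((1 + t) * Fintype.card B)) (by positivity) ?_
  have hpos := PosSemidef.smul (α := ℝ) ht (show 0 ≤ Fintype.card A / (1 + t) by positivity)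
  convert hpos using 1
  have h1 : choiMatrix Θ.1 = (Fintype.card A : ℂ) • choiState Θ.1 := by
    rw [choiState_eq, smul_inv_smul₀ hA]
  rw [h1, h]
  ext i j
  have h1t : (1 + t : ℂ) ≠ 0 := by exact_mod_cast (by positivity : (1 + t) ≠ 0)
  have hBC : (Fintype.card B : ℂ) ≠ 0 := by simp
  simp [maxMixed]
  field_simp
  ring

theorem channelVolume_univ_pos [Fintype A] [DecidableEq A] [Nonempty A] [Fintype B] [Nonempty B] :
    0 < channelVolume (Set.univ : Set (QChannel A B)) := by
  classical
  rw [channelVolume_eq, setOf_exists_choiState_eq_choiBody]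
  exact MeasureTheory.Measure.measure_pos_of_mem_nhds _ choiBody_mem_nhds_zero

theorem channelVolume_univ_lt_top [Fintype A] [DecidableEq A] [Nonempty A] [Fintype B]
    [Nonempty B] : channelVolume (Set.univ : Set (QChannel A B)) < ⊤ := by
  classical
  rw [channelVolume_eq, setOf_exists_choiState_eq_choiBody]
  exact isBounded_choiBody.measure_lt_top

theorem channelVolume_allowsPerfectCorrectionWithCoding [Fintype A] [DecidableEq A] [Nontrivial A]
    [Fintype B] [Nonempty B] :
    channelVolume {Θ : QChannel A B | AllowsPerfectCorrectionWithCoding Θ.1} = 0 := by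
  classical
  rw [channelVolume_eq]
  have h0 := (convex_choiBody (A := A) (B := B)).addHaar_frontier
    (MeasureTheory.Measure.euclideanHausdorffMeasure (Module.finrank ℝ (hsDirection A B)))
  refine MeasureTheory.measure_mono_null ?_ h0
  rintro w ⟨Θ, hΘ, h⟩
  have hw : w ∈ choiBody A B :=
    (congrArg PosSemidef h).mp (posSemidef_choiState Θ)
  exact ⟨subset_closure hw, fun hint =>
    not_allowsPerfectCorrectionWithCoding_of_mem_interior hint h hΘ⟩

theorem isQuantumOperation_id [Fintype A] : IsQuantumOperation (LinearMap.id : SuperOp A A) :=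
  ⟨fun k X hX => by
    have h : onSecond LinearMap.id X = X := rfl
    rwa [h], fun _ _ => le_rfl⟩

theorem AllowsPerfectCorrection.withCoding [Fintype A] [Fintype B] {Θ : SuperOp A B}
    (h : AllowsPerfectCorrection Θ) : AllowsPerfectCorrectionWithCoding Θ := by
  obtain ⟨D, p, hD, hp, h⟩ := h
  exact ⟨LinearMap.id, D, p, isQuantumOperation_id, hD, hp, h⟩

/-! ### Tensor products of operators -/

/-- The operator `⨂ i, M i`. -/
def tensor [Fintype ι] (M : ι → Matrix A B ℂ) : Matrix (ι → A) (ι → B) ℂ :=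
  Matrix.of fun s t => ∏ i, M i (s i) (t i)

theorem tensor_mul [Fintype ι] [DecidableEq ι] {C : Type*} [Fintype B] (M : ι → Matrix A B ℂ)
    (N : ι → Matrix B C ℂ) : tensor M * tensor N = tensor fun i => M i * N i := by
  ext s t
  simp only [tensor, Matrix.mul_apply, of_apply, ← Finset.prod_mul_distrib]
  rw [Finset.prod_univ_sum, Fintype.piFinset_univ]

theorem sum_tensor [Fintype ι] [DecidableEq ι] [Fintype S] (K : ι → S → Matrix A B ℂ) :
    ∑ s : ι → S, tensor (fun i => K i (s i)) = tensor fun i => ∑ t, K i t := by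
  ext s t
  simp only [tensor, Matrix.sum_apply, of_apply]
  rw [Finset.prod_univ_sum, Fintype.piFinset_univ]

theorem conjTranspose_tensor [Fintype ι] (M : ι → Matrix A B ℂ) :
    (tensor M)ᴴ = tensor fun i => (M i)ᴴ := by
  ext s t
  simp [tensor]

theorem tensor_diagonal [Fintype ι] [DecidableEq ι] [DecidableEq A] (v : ι → A → ℂ) :
    tensor (fun i => diagonal (v i)) = diagonal fun s => ∏ i, v i (s i) := by
  ext s t
  rcases eq_or_ne s t with rfl | h
  · simp [tensor]
  · obtain ⟨i, hi⟩ := Function.ne_iff.1 h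
    rw [diagonal_apply_ne _ h]
    exact Finset.prod_eq_zero (Finset.mem_univ i) (diagonal_apply_ne _ hi)

theorem tensor_one [Fintype ι] [DecidableEq ι] [DecidableEq A] :
    tensor (fun _ : ι => (1 : Matrix A A ℂ)) = 1 := by
  simpa [← diagonal_one] using tensor_diagonal fun (_ : ι) (_ : A) => (1 : ℂ)

theorem tensor_smul [Fintype ι] (c : ℂ) (M : ι → Matrix A B ℂ) :
    tensor (fun i => c • M i) = c ^ Fintype.card ι • tensor M := by
  ext s t
  simp [tensor, Finset.prod_mul_distrib]

/-- The product of the channels with Kraus operators `K i`. -/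
def productChannel [Fintype ι] [DecidableEq ι] [Fintype S] [Fintype A] [DecidableEq A]
    (K : ι → S → Matrix A A ℂ) (hK : ∀ i, ∑ s, (K i s)ᴴ * K i s = 1) :
    QChannel (ι → A) (ι → A) :=
  krausChannel (fun s : ι → S => tensor fun i => K i (s i)) (by
    simp only [conjTranspose_tensor, tensor_mul]
    rw [sum_tensor fun i t => (K i t)ᴴ * K i t]
    simp only [hK, tensor_one])

theorem isLocalErrorChannel_productChannel {n : ℕ} [Fintype S]
    (K : Fin n → S → Matrix (Fin 2) (Fin 2) ℂ) (hK : ∀ i, ∑ s, (K i s)ᴴ * K i s = 1) :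
    IsLocalErrorChannel (fun i => krausChannel (K i) (hK i)) (productChannel K hK) := by
  intro X
  change krausMap _ (tensor X) = tensor fun i => krausMap (K i) (X i)
  simp only [krausMap_apply, conjTranspose_tensor, tensor_mul]
  exact sum_tensor fun i t => K i t * X i * (K i t)ᴴ

/-! ### Correction and filters -/

theorem isQuantumOperation_of_channel [Fintype A] [Fintype B] (Θ : QChannel A B) :
    IsQuantumOperation Θ.1 :=
  ⟨Θ.2.1, fun X _ => (congrArg Complex.re (Θ.2.2 X)).le⟩

theorem isQuantumOperation_diagonal [Fintype A] [DecidableEq A] {v : A → ℂ}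
    (hv : ∀ i, ‖v i‖ ≤ 1) : IsQuantumOperation (krausMap fun _ : Unit => diagonal v) := by
  refine ⟨isCP_krausMap _, fun X hX => ?_⟩
  simp only [Matrix.trace, Complex.re_sum]
  refine Finset.sum_le_sum fun i _ => ?_
  have h0 := (Complex.le_def.1 (hX.diag_nonneg (i := i)))
  have h : (krausMap (fun _ : Unit => diagonal v) X) i i = ((‖v i‖ ^ 2 : ℝ) : ℂ) * X i i := by
    rw [krausMap_apply, Fintype.sum_unique, diagonal_conjTranspose, mul_diagonal, diagonal_mul,
      mul_right_comm, Pi.star_apply, Complex.star_def, Complex.mul_conj, Complex.normSq_eq_norm_sq]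
  rw [diag_apply, diag_apply, h, Complex.re_ofReal_mul]
  exact mul_le_of_le_one_left h0.1 (pow_le_one₀ (norm_nonneg _) (hv i))

/-- No channel with a nonzero singular Kraus operator allows perfect correction. -/
theorem not_allowsPerfectCorrectionWithCoding_of_singular [Fintype S] [Fintype A] [DecidableEq A]
    [Nonempty A] {K : S → Matrix A A ℂ} {s : S} (hs : K s ≠ 0) (hu : ¬ IsUnit (K s)) :
    ¬ AllowsPerfectCorrectionWithCoding (krausMap K) := by
  intro h
  obtain ⟨L, M, hLM, t, ht⟩ := h.exists_filters
  have unit : ∀ r, L * K r * M ≠ 0 → IsUnit (L * K r * M) := by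
    intro r hr
    obtain ⟨z, hz⟩ := hLM r
    rw [hz] at hr ⊢
    have hz0 : z ≠ 0 := fun h0 => hr (by rw [h0, zero_smul])
    rw [← Algebra.algebraMap_eq_smul_one]
    exact (IsUnit.mk0 z hz0).map (algebraMap ℂ (Matrix A A ℂ))
  -- All matrices are square, so one invertible product makes both filters invertible; then `L * K s
  -- * M` is nonzero, hence invertible, and so is `K s`.
  have hM : IsUnit M := isUnit_of_mul_isUnit_right (unit t ht)
  have hL : IsUnit L := isUnit_of_mul_isUnit_left (isUnit_of_mul_isUnit_left (unit t ht))
  refine hu ?_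
  have hne : L * K s * M ≠ 0 := by
    rw [Ne, hM.mul_left_eq_zero, hL.mul_right_eq_zero]
    exact hs
  exact isUnit_of_mul_isUnit_right (isUnit_of_mul_isUnit_left (unit s hne))

/-- Quasi-probabilistic correction by diagonal filters which, up to a small factor, turn one Kraus
operator into operators tending to the identity and the others into operators tending to zero. -/
theorem allowsQuasiCorrection_of_filters [Fintype S] [DecidableEq S] [Fintype A] [DecidableEq A]
    {K : S → Matrix A A ℂ} (e d : ℝ → A → ℂ) (c : ℝ → ℝ) (M : ℝ → S → Matrix A A ℂ) (s₀ : S)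
    (he : ∀ x ∈ Set.Ioc (0 : ℝ) 1, ∀ i, ‖e x i‖ ≤ 1)
    (hd : ∀ x ∈ Set.Ioc (0 : ℝ) 1, ∀ i, ‖d x i‖ ≤ 1)
    (hc : ∀ x ∈ Set.Ioc (0 : ℝ) 1, 0 < c x) (hc0 : Tendsto c (𝓝 0) (𝓝 0))
    (h : ∀ x s, diagonal (d x) * K s * diagonal (e x) = (c x : ℂ) • M x s)
    (hM : ∀ s, Continuous fun x => M x s) (hM0 : ∀ s, M 0 s = if s = s₀ then 1 else 0) :
    AllowsQuasiCorrection (krausMap K) := by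
  let x : ℕ → ℝ := fun n => 1 / ((n : ℝ) + 1)
  have hx : ∀ n, x n ∈ Set.Ioc (0 : ℝ) 1 := fun n =>
    ⟨Nat.one_div_pos_of_nat, by
      simpa [x] using inv_le_one_of_one_le₀ (by linarith [n.cast_nonneg (α := ℝ)])⟩
  have hx0 : Tendsto x atTop (𝓝 0) := tendsto_one_div_add_atTop_nhds_zero_nat
  refine ⟨fun n => krausMap fun _ : Unit => diagonal (e (x n)),
    -- The factor `c` multiplies each Kraus operator and so enters the map squared.
    fun n => krausMap fun _ : Unit => diagonal (d (x n)), fun n => c (x n) ^ 2,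
    fun n => ⟨isQuantumOperation_diagonal (he _ (hx n)), isQuantumOperation_diagonal (hd _ (hx n)),
      pow_pos (hc _ (hx n)) 2⟩, by simpa using (hc0.comp hx0).pow 2, fun X => ?_⟩
  have hcont : Continuous fun t => krausMap (M t) X := by
    simp only [krausMap_apply]
    exact continuous_finsetSum _ fun s _ =>
      ((hM s).matrix_mul continuous_const).matrix_mul (hM s).matrix_conjTranspose
  have hlim : krausMap (M 0) X = X := by
    simp [krausMap_apply, hM0, apply_ite, ite_mul]
  have := (hcont.tendsto 0).comp hx0
  rw [hlim] at this
  refine this.congr fun n => ?_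
  have hcn : (c (x n) : ℂ) ≠ 0 := by exact_mod_cast (hc _ (hx n)).ne'
  have hsum : krausMap (fun _ : Unit => diagonal (d (x n))) (krausMap K
      (krausMap (fun _ : Unit => diagonal (e (x n))) X)) =
      krausMap (fun s => (c (x n) : ℂ) • M (x n) s) X := by
    simp only [← h, krausMap_apply, Fintype.sum_unique, Matrix.mul_sum, Matrix.sum_mul,
      conjTranspose_mul, Matrix.mul_assoc]
  rw [hsum]
  simp only [krausMap_apply, Function.comp, conjTranspose_smul, Matrix.smul_mul, Matrix.mul_smul,
    smul_smul, ← Finset.smul_sum, Complex.star_def, Complex.conj_ofReal, Complex.ofReal_pow]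
  rw [← sq, inv_mul_cancel₀ (pow_ne_zero 2 hcn), one_smul]

/-! ### Amplitude damping -/

/-- Kraus operators of the amplitude damping of the basis state `|0⟩` to the basis state `|1⟩`. -/
noncomputable def dampingKraus (γ : ℝ) : Fin 2 → Matrix (Fin 2) (Fin 2) ℂ :=
  ![diagonal ![(Real.sqrt (1 - γ) : ℂ), 1], (Real.sqrt γ : ℂ) • Matrix.single 1 0 1]

theorem sum_dampingKraus {γ : ℝ} (h0 : 0 < γ) (h1 : γ < 1) :
    ∑ s, (dampingKraus γ s)ᴴ * dampingKraus γ s = 1 := by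
  have e0 : (Real.sqrt γ : ℂ) * Real.sqrt γ = γ := by
    rw [← Complex.ofReal_mul, Real.mul_self_sqrt h0.le]
  have e1 : (Real.sqrt (1 - γ) : ℂ) * Real.sqrt (1 - γ) = 1 - γ := by
    rw [← Complex.ofReal_mul, Real.mul_self_sqrt (by linarith)]; simp
  ext i j
  fin_cases i <;> fin_cases j <;>
    simp [dampingKraus, Fin.sum_univ_two, e0, e1]

/-- What the filters make of the Kraus operators of amplitude damping. -/
noncomputable def dampingFiltered (γ x : ℝ) : Fin 2 → Matrix (Fin 2) (Fin 2) ℂ :=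
  ![1, ((x * Real.sqrt γ : ℝ) : ℂ) • Matrix.single 1 0 1]

/-- The factor `√(1 - γ)` in the receiver's filter balances the no-jump operator to an exact
multiple of the identity. The jump `|0⟩ → |1⟩` meets both attenuations, hence the extra `x`. -/
theorem filter_mul_dampingKraus (γ x : ℝ) (s : Fin 2) :
    diagonal ![1, ((x * Real.sqrt (1 - γ) : ℝ) : ℂ)] * dampingKraus γ s * diagonal ![(x : ℂ), 1] =
      ((x * Real.sqrt (1 - γ) : ℝ) : ℂ) • dampingFiltered γ x s := by
  ext i j
  fin_cases s <;> fin_cases i <;> fin_cases j <;>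
    simp [dampingKraus, dampingFiltered, Matrix.mul_apply, Fin.sum_univ_two] <;> ring

theorem continuous_dampingFiltered (γ : ℝ) (s : Fin 2) :
    Continuous fun x => dampingFiltered γ x s := by
  fin_cases s
  · exact continuous_const
  · have : Continuous fun x : ℝ =>
        ((x * Real.sqrt γ : ℝ) : ℂ) • (Matrix.single 1 0 1 : Matrix (Fin 2) (Fin 2) ℂ) := by
      fun_prop
    exact this

theorem dampingFiltered_zero (γ : ℝ) (s : Fin 2) :
    dampingFiltered γ 0 s = if s = 0 then 1 else 0 := by
  fin_cases s <;> simp [dampingFiltered]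

theorem norm_filter_le (x : ℝ) (hx : x ∈ Set.Ioc (0 : ℝ) 1) (i : Fin 2) :
    ‖(![(x : ℂ), 1] : Fin 2 → ℂ) i‖ ≤ 1 := by
  fin_cases i <;> simp [abs_of_pos hx.1, hx.2]

theorem norm_filter_le' {γ : ℝ} (h0 : 0 < γ) (x : ℝ) (hx : x ∈ Set.Ioc (0 : ℝ) 1)
    (i : Fin 2) : ‖(![1, ((x * Real.sqrt (1 - γ) : ℝ) : ℂ)] : Fin 2 → ℂ) i‖ ≤ 1 := by
  have h := mul_le_one₀ hx.2 (Real.sqrt_nonneg (1 - γ))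
    (Real.sqrt_le_one.2 (by linarith : 1 - γ ≤ 1))
  fin_cases i
  · simp
  · simpa [abs_of_pos hx.1, abs_of_nonneg (Real.sqrt_nonneg _)] using h

theorem allowsQuasiCorrection_damping {γ : ℝ} (h0 : 0 < γ) (h1 : γ < 1) :
    AllowsQuasiCorrection (krausMap (dampingKraus γ)) := by
  refine allowsQuasiCorrection_of_filters (fun x => ![(x : ℂ), 1])
    (fun x => ![1, ((x * Real.sqrt (1 - γ) : ℝ) : ℂ)]) (fun x => x * Real.sqrt (1 - γ))
    (dampingFiltered γ) 0 norm_filter_le (norm_filter_le' h0)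
    (fun x hx => mul_pos hx.1 (Real.sqrt_pos.2 (by linarith))) ?_ (filter_mul_dampingKraus γ)
    (continuous_dampingFiltered γ) (dampingFiltered_zero γ)
  have : Continuous fun x : ℝ => x * Real.sqrt (1 - γ) := by fun_prop
  simpa using this.tendsto 0

theorem not_allowsPerfectCorrectionWithCoding_damping {γ : ℝ} (h0 : 0 < γ) :
    ¬ AllowsPerfectCorrectionWithCoding (krausMap (dampingKraus γ)) := by
  refine not_allowsPerfectCorrectionWithCoding_of_singular (s := 1) (fun h => ?_) fun h => ?_
  · have := congrFun (congrFun h 1) 0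
    simp [dampingKraus, (Real.sqrt_pos.2 h0).ne'] at this
  · rw [Matrix.isUnit_iff_isUnit_det] at h
    simp [dampingKraus, det_fin_two] at h

/-- The filters act qubit by qubit. A Kraus string containing a jump carries an extra factor `x` for
each jump, so only the all-zero string survives at `x = 0`. -/
theorem allowsQuasiCorrection_damping_product [Fintype ι] [DecidableEq ι] [Nonempty ι] {γ : ℝ}
    (h0 : 0 < γ) (h1 : γ < 1) :
    AllowsQuasiCorrection
      (krausMap fun s : ι → Fin 2 => tensor fun i => dampingKraus γ (s i)) := by
  refine allowsQuasiCorrection_of_filters (fun x s => ∏ i, (![(x : ℂ), 1] : Fin 2 → ℂ) (s i))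
    (fun x s => ∏ i, (![1, ((x * Real.sqrt (1 - γ) : ℝ) : ℂ)] : Fin 2 → ℂ) (s i))
    (fun x => (x * Real.sqrt (1 - γ)) ^ Fintype.card ι)
    (fun x s => tensor fun i => dampingFiltered γ x (s i)) 0
    (fun x hx s => ?_) (fun x hx s => ?_)
    (fun x hx => pow_pos (mul_pos hx.1 (Real.sqrt_pos.2 (by linarith))) _) ?_ (fun x s => ?_)
    (fun s => ?_) (fun s => ?_)
  · rw [norm_prod]
    exact Finset.prod_le_one (fun _ _ => norm_nonneg _) fun i _ => norm_filter_le x hx _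
  · rw [norm_prod]
    exact Finset.prod_le_one (fun _ _ => norm_nonneg _) fun i _ => norm_filter_le' h0 x hx _
  · have : Continuous fun x : ℝ => (x * Real.sqrt (1 - γ)) ^ Fintype.card ι := by fun_prop
    simpa using this.tendsto 0
  · rw [← tensor_diagonal, ← tensor_diagonal, tensor_mul, tensor_mul]
    simp only [filter_mul_dampingKraus]
    rw [tensor_smul, Complex.ofReal_pow]
  · refine continuous_matrix fun a b => ?_
    exact continuous_finsetProd _ fun i _ =>
      (continuous_dampingFiltered γ (s i)).matrix_elem _ _
  · simp only [dampingFiltered_zero]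
    split_ifs with hs
    · simp [hs, tensor_one]
    · obtain ⟨i, hi⟩ := Function.ne_iff.1 hs
      ext a b
      refine Finset.prod_eq_zero (Finset.mem_univ i) ?_
      simp only [Pi.zero_apply] at hi
      simp [hi]

theorem not_allowsPerfectCorrectionWithCoding_damping_product [Fintype ι] [DecidableEq ι]
    [Nonempty ι] {γ : ℝ} (h0 : 0 < γ) :
    ¬ AllowsPerfectCorrectionWithCoding
      (krausMap fun s : ι → Fin 2 => tensor fun i => dampingKraus γ (s i)) := by
  -- The string with a jump on every qubit is nonzero, but its row at the all-zero index vanishes.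
  refine not_allowsPerfectCorrectionWithCoding_of_singular (s := fun _ => 1)
    (fun h => ?_) fun h => ?_
  · have := congrFun (congrFun h fun _ => 1) fun _ => 0
    simp [tensor, dampingKraus, (Real.sqrt_pos.2 h0).ne'] at this
  · rw [Matrix.isUnit_iff_isUnit_det, Matrix.det_eq_zero_of_row_eq_zero (fun _ => 0)] at h
    · simp at h
    · intro t
      exact Finset.prod_eq_zero (Finset.mem_univ (Classical.arbitrary ι)) (by simp [dampingKraus])

/-! ### Bit flips -/

/-- The Kraus operator of the bit flip. -/
def bitFlip : Matrix (Fin 2) (Fin 2) ℂ := !![0, 1; 1, 0]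

theorem bitFlip_mul_self : bitFlip * bitFlip = 1 := by
  simp [bitFlip, one_fin_two]

theorem conjTranspose_bitFlip : bitFlipᴴ = bitFlip := by
  ext i j
  fin_cases i <;> fin_cases j <;> simp [bitFlip]

theorem sum_bitFlip : ∑ _s : Unit, bitFlipᴴ * bitFlip = 1 := by
  rw [Fintype.sum_unique, conjTranspose_bitFlip, bitFlip_mul_self]

theorem krausMap_bitFlip_ne_id : krausMap (fun _ : Unit => bitFlip) ≠ LinearMap.id := by
  intro h
  have := congrFun (congrFun (congrArg (fun Φ => Φ (Matrix.single 0 0 1)) h) 0) 0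
  rw [krausMap_apply, Fintype.sum_unique, conjTranspose_bitFlip, Matrix.mul_apply] at this
  simp [bitFlip, Matrix.mul_apply, Fin.sum_univ_two] at this

theorem allowsPerfectCorrection_bitFlip_product [Fintype ι] [DecidableEq ι] :
    AllowsPerfectCorrection
      (productChannel (fun (_ : ι) (_ : Unit) => bitFlip) fun _ => sum_bitFlip).1 := by
  refine ⟨_, 1, isQuantumOperation_of_channel
    (productChannel (fun (_ : ι) (_ : Unit) => bitFlip) fun _ => sum_bitFlip), one_pos,
    fun X => ?_⟩
  change krausMap _ (krausMap _ X) = _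
  have hT : tensor (fun _ : ι => bitFlip) * tensor (fun _ : ι => bitFlip) = 1 := by
    simp only [tensor_mul, bitFlip_mul_self, tensor_one]
  simp only [krausMap_apply, Fintype.sum_unique, conjTranspose_tensor, conjTranspose_bitFlip]
  rw [Matrix.mul_assoc, Matrix.mul_assoc, Matrix.mul_assoc, hT, ← Matrix.mul_assoc, hT]
  simp

/-! ### The example -/

theorem conjBy_diagonal_apply [Fintype A] [DecidableEq A] (v : A → ℂ) (X : Matrix A A ℂ)
    (i j : A) : conjBy (diagonal v) X i j = v i * X i j * star (v j) := by
  simp [conjBy, diagonal_conjTranspose, mul_assoc]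

theorem diagonal_kronecker_one' [DecidableEq A] [DecidableEq B] (v : A → ℂ) :
    diagonal v ⊗ₖ (1 : Matrix B B ℂ) = diagonal fun x : A × B => v x.1 := by
  rw [← diagonal_one, diagonal_kronecker_diagonal]; simp

theorem one_kronecker_diagonal' [DecidableEq A] [DecidableEq B] (v : B → ℂ) :
    (1 : Matrix A A ℂ) ⊗ₖ diagonal v = diagonal fun x : A × B => v x.2 := by
  rw [← diagonal_one, diagonal_kronecker_diagonal]; simp

theorem exampleState_apply (a b : ℝ) (x y : Fin 2 × Fin 2) :
    exampleState a b x y = ((b / (a + b) : ℝ) : ℂ) *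
      ((!![(a : ℂ), 0; 0, b] x.1 x.2) * (!![(a : ℂ), 0; 0, b] y.1 y.2)) +
      ((a / (a + b) : ℝ) : ℂ) *
        ((!![(0 : ℂ), 1; 0, 0] x.1 x.2) * (!![(0 : ℂ), 1; 0, 0] y.1 y.2)) := by
  obtain ⟨i, j⟩ := x
  obtain ⟨k, l⟩ := y
  fin_cases i <;> fin_cases j <;> fin_cases k <;> fin_cases l <;>
    simp [exampleState, ketbra, ket, vecMulVec_apply]

theorem isState_exampleState {a b : ℝ} (ha : 0 < a) (hb : 0 < b) (hab : a ^ 2 + b ^ 2 = 1) :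
    IsState (exampleState a b) := by
  have h1 : (0 : ℂ) ≤ ((b / (a + b) : ℝ) : ℂ) := by
    exact_mod_cast (by positivity : 0 ≤ b / (a + b))
  have h2 : (0 : ℂ) ≤ ((a / (a + b) : ℝ) : ℂ) := by
    exact_mod_cast (by positivity : 0 ≤ a / (a + b))
  refine ⟨((posSemidef_vecMulVec_self_star _).smul h1).add
    ((posSemidef_vecMulVec_self_star _).smul h2), ?_⟩
  have h : b / (a + b) * (a * a + b * b) + a / (a + b) = 1 := by
    rw [← sq, ← sq, hab]; field_simp; ring
  simp only [Matrix.trace, diag_apply, exampleState_apply, Fintype.sum_prod_type,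
    Fin.sum_univ_two]
  simp
  have h' := congrArg ((↑) : ℝ → ℂ) h
  push_cast at h'
  linear_combination h'

/-- The operator that turns the Choi state of amplitude damping into the example. -/
noncomputable def exampleFilter (a b : ℝ) : Fin 2 → ℂ :=
  ![(Real.sqrt (2 * a * (1 + a * b) / (a + b)) : ℂ), ((b * Real.sqrt (2 * b / (a + b)) : ℝ) : ℂ)]

/-- The Choi state of damping is `½ |v⟩⟨v| + ½ γ |01⟩⟨01|` with `v = √(1-γ) |00⟩ + |11⟩`. Applying
`diag(u, w)` and matching coefficients gives `u² γ = 2a/(a+b)`, `u² (1-γ) = 2a²b/(a+b)` and `w² =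
2b³/(a+b)`. The ratio of the first two is `(1-γ)/γ = ab`, whence `γ = 1/(1+ab)`. -/
theorem exampleState_eq_conjBy_choiState {a b : ℝ} (ha : 0 < a) (hb : 0 < b) :
    exampleState a b = conjBy (diagonal (exampleFilter a b) ⊗ₖ (1 : Matrix (Fin 2) (Fin 2) ℂ))
      (choiState (krausMap (dampingKraus (1 / (1 + a * b))))) := by
  have hq : Real.sqrt (2 * a * (1 + a * b) / (a + b)) * Real.sqrt (1 - 1 / (1 + a * b)) =
      a * Real.sqrt (2 * b / (a + b)) := by
    rw [← Real.sqrt_mul (by positivity), ← Real.sqrt_sq ha.le, ← Real.sqrt_mul (by positivity),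
      Real.sqrt_sq ha.le]
    congr 1
    field_simp
    ring
  have hm : Real.sqrt (2 * b / (a + b)) * Real.sqrt (2 * b / (a + b)) = 2 * (b / (a + b)) := by
    rw [Real.mul_self_sqrt (by positivity)]; ring
  have hg : (Real.sqrt (2 * a * (1 + a * b) / (a + b)) * Real.sqrt (1 / (1 + a * b))) *
      (Real.sqrt (2 * a * (1 + a * b) / (a + b)) * Real.sqrt (1 / (1 + a * b))) =
      2 * (a / (a + b)) := by
    rw [← Real.sqrt_mul (by positivity), Real.mul_self_sqrt (by positivity)]
    field_simp
  rw [diagonal_kronecker_one']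
  ext ⟨i, j⟩ ⟨k, l⟩
  rw [conjBy_diagonal_apply, choiState_eq, Matrix.smul_apply, choiMatrix_krausMap,
    exampleState_apply, Fin.sum_univ_two, exampleFilter, dampingKraus]
  generalize Real.sqrt (2 * a * (1 + a * b) / (a + b)) = u at *
  generalize Real.sqrt (1 - 1 / (1 + a * b)) = q at *
  generalize Real.sqrt (1 / (1 + a * b)) = g at *
  generalize Real.sqrt (2 * b / (a + b)) = m at *
  generalize b / (a + b) = s at *
  generalize a / (a + b) = t at *
  have hq' : (u : ℂ) * q = a * m := by exact_mod_cast hq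
  have hm' : (m : ℂ) * m = 2 * s := by exact_mod_cast hm
  have hg' : ((u : ℂ) * g) * (u * g) = 2 * t := by exact_mod_cast hg
  fin_cases i <;> fin_cases j <;> fin_cases k <;> fin_cases l <;> simp
  · linear_combination (-(u * q + a * m) / 2) * hq' - (a ^ 2 / 2) * hm'
  · linear_combination (-(b * m) / 2) * hq' - (a * b / 2) * hm'
  · linear_combination (-1 / 2) * hg'
  · linear_combination (-(b * m) / 2) * hq' - (a * b / 2) * hm'
  · linear_combination (-b ^ 2 / 2) * hm'

/-- The two outcomes of a measurement with diagonal Kraus operators. -/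
theorem sum_diagonal_filters [DecidableEq A] [Fintype A] {v w : A → ℝ}
    (h : ∀ i, v i ^ 2 + w i ^ 2 = 1) :
    ∑ j : Fin 2, ((![diagonal fun i => (v i : ℂ), diagonal fun i => (w i : ℂ)] :
      Fin 2 → Matrix A A ℂ) j)ᴴ * (![diagonal fun i => (v i : ℂ), diagonal fun i => (w i : ℂ)] :
      Fin 2 → Matrix A A ℂ) j = 1 := by
  rw [Fin.sum_univ_two]
  simp only [cons_val_zero, cons_val_one, diagonal_conjTranspose, diagonal_mul_diagonal,
    diagonal_add, ← diagonal_one]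
  congr 1
  ext i
  have := congrArg ((↑) : ℝ → ℂ) (h i)
  push_cast at this
  simp [← this, sq]

/-- The contraction is completed to a measurement by the Kraus operator `√(1 - v²)`, whose outcome
is discarded. -/
theorem IsLOCC.comp_alice_diagonal [Fintype A] [DecidableEq A] [Fintype B] [DecidableEq B]
    {Λ : SuperOp (A × B) (A × B)} (h : IsLOCC Λ) {v : A → ℝ} (hv : ∀ i, v i ^ 2 ≤ 1) :
    IsLOCC (Λ ∘ₗ conjBy (diagonal (fun i => (v i : ℂ)) ⊗ₖ (1 : Matrix B B ℂ))) := by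
  have ha := IsLOCC.alice (A := A) (B := B) _ ![Λ, 0]
    (sum_diagonal_filters (v := v) (w := fun i => Real.sqrt (1 - v i ^ 2)) fun i => by
      rw [Real.sq_sqrt (by linarith [hv i])]; ring)
    (by intro j; fin_cases j; exacts [h, .discard])
  rw [Fin.sum_univ_two] at ha
  simpa using ha

theorem IsLOCC.comp_bob_diagonal [Fintype A] [DecidableEq A] [Fintype B] [DecidableEq B]
    {Λ : SuperOp (A × B) (A × B)} (h : IsLOCC Λ) {v : B → ℝ} (hv : ∀ i, v i ^ 2 ≤ 1) :
    IsLOCC (Λ ∘ₗ conjBy ((1 : Matrix A A ℂ) ⊗ₖ diagonal (fun i => (v i : ℂ)))) := by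
  have hb := IsLOCC.bob (A := A) (B := B) _ ![Λ, 0]
    (sum_diagonal_filters (v := v) (w := fun i => Real.sqrt (1 - v i ^ 2)) fun i => by
      rw [Real.sq_sqrt (by linarith [hv i])]; ring)
    (by intro j; fin_cases j; exacts [h, .discard])
  rw [Fin.sum_univ_two] at hb
  simpa using hb

/-- Local diagonal filters are conclusive LOCC operations. -/
theorem isLOCC_diagonal [Fintype A] [DecidableEq A] [Fintype B] [DecidableEq B] {v : A → ℝ}
    {w : B → ℝ} (hv : ∀ i, v i ^ 2 ≤ 1) (hw : ∀ i, w i ^ 2 ≤ 1) :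
    IsLOCC (conjBy (diagonal fun x : A × B => ((v x.1 * w x.2 : ℝ) : ℂ))) := by
  convert (IsLOCC.keep.comp_bob_diagonal hw).comp_alice_diagonal hv using 1
  rw [diagonal_kronecker_one', one_kronecker_diagonal']
  refine LinearMap.ext fun X => Matrix.ext fun i j => ?_
  simp only [LinearMap.comp_apply, LinearMap.id_apply, conjBy_diagonal_apply,
    Complex.star_def, Complex.conj_ofReal, Complex.ofReal_mul, map_mul]
  ring

theorem isQuasiDistillable_exampleState {a b : ℝ} (ha : 0 < a) (hb : 0 < b)
    (hab : a ^ 2 + b ^ 2 = 1) : IsQuasiDistillable (exampleState a b) := by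
  let x : ℕ → ℝ := fun n => 1 / ((n : ℝ) + 1)
  have hx0 : ∀ n, 0 < x n := fun n => Nat.one_div_pos_of_nat
  have hx1 : ∀ n, x n ≤ 1 := fun n => by
    simpa [x] using inv_le_one_of_one_le₀ (by linarith [n.cast_nonneg (α := ℝ)])
  have hx : Tendsto x atTop (𝓝 0) := tendsto_one_div_add_atTop_nhds_zero_nat
  let T : ℝ → ℝ := fun t => 2 * a ^ 2 * b ^ 3 / (a + b) + t ^ 2 * (a ^ 3 / (a + b))
  have hT : ∀ t, 0 < T t := fun t => by positivity
  -- The filters `diag(t, 1)` and `diag(b, t a)` send `Ψ` to `t a b (|00⟩ + |11⟩)` and `|01⟩` to `t²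
  -- a |01⟩`. The noise is thus of higher order in `t`, and `t² * T t` is the total success
  -- probability.
  let Λ : ℝ → SuperOp (Fin 2 × Fin 2) (Fin 2 × Fin 2) := fun t => conjBy (diagonal
    fun y : Fin 2 × Fin 2 => (((![t, 1] : Fin 2 → ℝ) y.1 * (![b, t * a] : Fin 2 → ℝ) y.2 : ℝ) : ℂ))
  have htr : ∀ t, (Λ t (exampleState a b)).trace = ((t ^ 2 * T t : ℝ) : ℂ) := by
    intro t
    simp only [Matrix.trace, diag_apply, Λ, conjBy_diagonal_apply, exampleState_apply,
      Fintype.sum_prod_type, Fin.sum_univ_two]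
    simp [T]
    ring
  have hsf : ∀ t, 0 < t → singletFraction (((Λ t (exampleState a b)).trace)⁻¹ •
      Λ t (exampleState a b)) = (T t)⁻¹ * (2 * a ^ 2 * b ^ 3 / (a + b)) := by
    intro t ht
    rw [htr]
    have hs : (Real.sqrt 2 : ℂ)⁻¹ * (Real.sqrt 2 : ℂ)⁻¹ = 1 / 2 := by
      rw [← mul_inv, ← Complex.ofReal_mul, Real.mul_self_sqrt (by norm_num)]; simp
    rw [← Complex.ofReal_re ((T t)⁻¹ * (2 * a ^ 2 * b ^ 3 / (a + b))), singletFraction]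
    congr 1
    simp only [dotProduct, mulVec, Fintype.sum_prod_type, Fin.sum_univ_two, psiPlus,
      Matrix.smul_apply, Λ, conjBy_diagonal_apply, exampleState_apply]
    have ht' : ((t : ℂ) ^ 2)⁻¹ * (t : ℂ) ^ 2 = 1 := inv_mul_cancel₀ (by simp [ht.ne'])
    simp [psiPlus]
    linear_combination
      (4 * ((T t : ℂ)⁻¹ * (b / (a + b)) * a ^ 2 * b ^ 2) * (((t : ℂ) ^ 2)⁻¹ * (t : ℂ) ^ 2)) * hs +
      (2 * ((T t : ℂ)⁻¹ * (b / (a + b)) * a ^ 2 * b ^ 2)) * ht'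
  refine ⟨fun n => Λ (x n), fun n => ⟨isLOCC_diagonal ?_ ?_, ?_⟩, ?_, ?_⟩
  · intro i
    fin_cases i
    · exact pow_le_one₀ (hx0 n).le (hx1 n)
    · simp
  · intro i
    fin_cases i
    · change b ^ 2 ≤ 1
      nlinarith
    · change (x n * a) ^ 2 ≤ 1
      exact pow_le_one₀ (mul_nonneg (hx0 n).le ha.le)
        (mul_le_one₀ (hx1 n) ha.le (by nlinarith))
  · rw [htr, Complex.ofReal_re]
    exact mul_pos (pow_pos (hx0 n) 2) (hT _)
  · simp only [htr, Complex.ofReal_re]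
    have hc : Continuous fun t => t ^ 2 * T t := by fun_prop
    have h := (hc.tendsto 0).comp hx
    rwa [zero_pow two_ne_zero, zero_mul] at h
  · have hc : Tendsto (fun t => (T t)⁻¹ * (2 * a ^ 2 * b ^ 3 / (a + b))) (𝓝 0) (𝓝 1) := by
      have h1 : ContinuousAt (fun t => (T t)⁻¹ * (2 * a ^ 2 * b ^ 3 / (a + b))) 0 := by
        have : Continuous T := by fun_prop
        exact (this.continuousAt.inv₀ (hT 0).ne').mul continuousAt_const
      have h2 : (T 0)⁻¹ * (2 * a ^ 2 * b ^ 3 / (a + b)) = 1 := by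
        have : T 0 = 2 * a ^ 2 * b ^ 3 / (a + b) := by simp [T]
        rw [this, inv_mul_cancel₀ (by positivity)]
      simpa only [ContinuousAt, h2] using h1
    exact (hc.comp hx).congr fun n => (hsf _ (hx0 n)).symm

theorem damping_parameter_mem {a b : ℝ} (ha : 0 < a) (hb : 0 < b) :
    0 < 1 / (1 + a * b) ∧ 1 / (1 + a * b) < 1 := by
  have := mul_pos ha hb
  exact ⟨by positivity, by rw [div_lt_one (by positivity)]; linarith⟩

theorem posDef_exampleFilter {a b : ℝ} (ha : 0 < a) (hb : 0 < b) :
    (diagonal (exampleFilter a b)).PosDef := by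
  refine PosDef.diagonal fun i => ?_
  fin_cases i
  · simpa [exampleFilter] using (by positivity : 0 < Real.sqrt (2 * a * (1 + a * b) / (a + b)))
  · exact Complex.zero_lt_real.2 (by positivity : 0 < b * Real.sqrt (2 * b / (a + b)))

/-- The equation `2b³ = a + b` is the requirement that the lower entry of `exampleFilter` be 1; with
normalization the upper entry is then 1 as well. A solution comes from the intermediate value
theorem, the function going from -1 at `b = 0` to 1 at `b = 1`. -/
theorem exists_amplitudes :
    ∃ a b : ℝ, 0 < a ∧ 0 < b ∧ a ^ 2 + b ^ 2 = 1 ∧ 2 * b ^ 3 = a + b := by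
  have hc : ContinuousOn (fun b : ℝ => 2 * b ^ 3 - b - Real.sqrt (1 - b ^ 2)) (Set.Icc 0 1) := by
    fun_prop
  obtain ⟨b, ⟨hb0, hb1⟩, hb⟩ := intermediate_value_Icc zero_le_one hc
    (show (0 : ℝ) ∈ Set.Icc _ _ by norm_num)
  have hb : 2 * b ^ 3 - b - Real.sqrt (1 - b ^ 2) = 0 := hb
  have h0 : b ≠ 0 := by rintro rfl; norm_num at hb
  have h1 : b ≠ 1 := by rintro rfl; norm_num at hb
  have h0' : 0 < b := lt_of_le_of_ne hb0 h0.symm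
  have h1' : b < 1 := lt_of_le_of_ne hb1 h1
  have hpos : 0 < 1 - b ^ 2 := by nlinarith
  refine ⟨Real.sqrt (1 - b ^ 2), b, Real.sqrt_pos.2 hpos, h0', ?_, by linarith⟩
  rw [Real.sq_sqrt hpos.le]; ring

theorem exampleFilter_eq_one {a b : ℝ} (ha : 0 < a) (hb : 0 < b) (hab : a ^ 2 + b ^ 2 = 1)
    (h : 2 * b ^ 3 = a + b) : diagonal (exampleFilter a b) = 1 := by
  have h1 : 2 * a * (1 + a * b) / (a + b) = 1 := by
    rw [div_eq_one_iff_eq (by positivity)]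
    linear_combination 2 * b * hab - h
  have h2 : b * Real.sqrt (2 * b / (a + b)) = 1 := by
    rw [← Real.sqrt_sq hb.le, ← Real.sqrt_mul (by positivity), Real.sqrt_sq hb.le,
      Real.sqrt_eq_one, ← h]
    field_simp
  rw [← diagonal_one]
  congr 1
  ext i
  fin_cases i <;> simp only [exampleFilter, h1, h2] <;> simp

end ProbQEC

theorem mainTheorem6 :
    -- the natural measure is a nontrivial finite measure on channels, and the channels that allow
    -- perfect probabilistic correction (without or with coding) have measure zero
    (∀ (A B : Type) [Fintype A] [DecidableEq A] [Nontrivial A]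
        [Fintype B] [Nonempty B],
      0 < ProbQEC.channelVolume (Set.univ : Set (ProbQEC.QChannel A B)) ∧
      ProbQEC.channelVolume (Set.univ : Set (ProbQEC.QChannel A B)) < ⊤ ∧
      ProbQEC.channelVolume
        {Θ : ProbQEC.QChannel A B | ProbQEC.AllowsPerfectCorrection Θ.1} = 0 ∧
      ProbQEC.channelVolume
        {Θ : ProbQEC.QChannel A B | ProbQEC.AllowsPerfectCorrectionWithCoding Θ.1} = 0) ∧
    -- for any number of qubits, some channels with nontrivial local errors on every qubit allow
    -- perfect correction, and some allow quasi-probabilistic but not perfect correction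
    (∀ n : ℕ, 1 ≤ n →
      (∃ (θ : Fin n → ProbQEC.QChannel (Fin 2) (Fin 2))
          (Θ : ProbQEC.QChannel (Fin n → Fin 2) (Fin n → Fin 2)),
        ProbQEC.IsLocalErrorChannel θ Θ ∧ (∀ i, (θ i).1 ≠ LinearMap.id) ∧
        ProbQEC.AllowsPerfectCorrection Θ.1) ∧
      (∃ (θ : Fin n → ProbQEC.QChannel (Fin 2) (Fin 2))
          (Θ : ProbQEC.QChannel (Fin n → Fin 2) (Fin n → Fin 2)),
        ProbQEC.IsLocalErrorChannel θ Θ ∧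
        (∀ i, ¬ ProbQEC.AllowsPerfectCorrectionWithCoding (θ i).1) ∧
        ProbQEC.AllowsQuasiCorrection Θ.1 ∧
        ¬ ProbQEC.AllowsPerfectCorrectionWithCoding Θ.1)) ∧
    -- the example: a quasidistillable state, obtained from the Choi state of a channel by an
    -- invertible local operator of the sender; that channel allows quasi-probabilistic correction
    (∀ a b : ℝ, 0 < a → 0 < b → a ^ 2 + b ^ 2 = 1 →
      ProbQEC.IsState (ProbQEC.exampleState a b) ∧
      ProbQEC.IsQuasiDistillable (ProbQEC.exampleState a b) ∧
      ∃ (θ : ProbQEC.QChannel (Fin 2) (Fin 2)) (C : Matrix (Fin 2) (Fin 2) ℂ),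
        C.PosDef ∧
        ProbQEC.exampleState a b =
          ProbQEC.conjBy (Matrix.kronecker C (1 : Matrix (Fin 2) (Fin 2) ℂ))
            (ProbQEC.choiState θ.1) ∧
        ProbQEC.AllowsQuasiCorrection θ.1 ∧
        ¬ ProbQEC.AllowsPerfectCorrectionWithCoding θ.1) ∧
    -- for suitable amplitudes the example is itself the Choi state of such a channel
    (∃ a b : ℝ, 0 < a ∧ 0 < b ∧ a ^ 2 + b ^ 2 = 1 ∧
      ∃ θ : ProbQEC.QChannel (Fin 2) (Fin 2),
        ProbQEC.choiState θ.1 = ProbQEC.exampleState a b ∧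
        ProbQEC.AllowsQuasiCorrection θ.1 ∧
        ¬ ProbQEC.AllowsPerfectCorrectionWithCoding θ.1) := by
  refine ⟨?_, ?_, ?_, ?_⟩
  · intro A B _ _ _ _ _
    exact ⟨ProbQEC.channelVolume_univ_pos, ProbQEC.channelVolume_univ_lt_top,
      MeasureTheory.measure_mono_null
        (Set.image_mono fun _ hΘ => ProbQEC.AllowsPerfectCorrection.withCoding hΘ)
        ProbQEC.channelVolume_allowsPerfectCorrectionWithCoding,
      ProbQEC.channelVolume_allowsPerfectCorrectionWithCoding⟩
  · intro n hn
    have : Nonempty (Fin n) := ⟨⟨0, hn⟩⟩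
    have h0 : (0 : ℝ) < 1 / 2 := by norm_num
    have h1 : (1 / 2 : ℝ) < 1 := by norm_num
    exact ⟨⟨_, _, ProbQEC.isLocalErrorChannel_productChannel _ fun _ => ProbQEC.sum_bitFlip,
        fun _ => ProbQEC.krausMap_bitFlip_ne_id,
        ProbQEC.allowsPerfectCorrection_bitFlip_product⟩,
      ⟨_, _, ProbQEC.isLocalErrorChannel_productChannel _ fun _ =>
          ProbQEC.sum_dampingKraus h0 h1,
        fun _ => ProbQEC.not_allowsPerfectCorrectionWithCoding_damping h0,
        ProbQEC.allowsQuasiCorrection_damping_product h0 h1,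
        ProbQEC.not_allowsPerfectCorrectionWithCoding_damping_product h0⟩⟩
  · intro a b ha hb hab
    obtain ⟨h0, h1⟩ := ProbQEC.damping_parameter_mem ha hb
    exact ⟨ProbQEC.isState_exampleState ha hb hab, ProbQEC.isQuasiDistillable_exampleState ha hb hab,
      ProbQEC.krausChannel _ (ProbQEC.sum_dampingKraus h0 h1),
      Matrix.diagonal (ProbQEC.exampleFilter a b), ProbQEC.posDef_exampleFilter ha hb,
      ProbQEC.exampleState_eq_conjBy_choiState ha hb, ProbQEC.allowsQuasiCorrection_damping h0 h1,
      ProbQEC.not_allowsPerfectCorrectionWithCoding_damping h0⟩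
  · obtain ⟨a, b, ha, hb, hab, h⟩ := ProbQEC.exists_amplitudes
    obtain ⟨h0, h1⟩ := ProbQEC.damping_parameter_mem ha hb
    refine ⟨a, b, ha, hb, hab, ProbQEC.krausChannel _ (ProbQEC.sum_dampingKraus h0 h1), ?_,
      ProbQEC.allowsQuasiCorrection_damping h0 h1,
      ProbQEC.not_allowsPerfectCorrectionWithCoding_damping h0⟩
    rw [ProbQEC.exampleState_eq_conjBy_choiState ha hb, ProbQEC.exampleFilter_eq_one ha hb hab h,
      Matrix.one_kronecker_one]
    simp [ProbQEC.conjBy, ProbQEC.krausChannel]
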